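/- Let $Q$ be a smooth finite-dimensional (Hausdorff, second countable) manifold, $P_L=TQ$, $P_C=T^*Q$, and let $L:P_L\to\mathbb R$ be a smooth Lagrangian with fibre derivative $\mathcal L:P_L\to P_C$, $\mathcal L(q,v)=(q,\partial L/\partial v)$. Let $M_{ab}(q,v)=\partial^2L/\partial v^a\partial v^b$ be the Hessian of $L$ along the fibres and let $\mathcal G$ be the vertical kernel distribution on $P_L$, $$\mathcal G_u=\Big\{z^a\frac{\partial}{\partial v^a}\;:\;M_{ab}(u)z^b=0\Big\}\subset T_uP_L .$$ Assume that $L$ is almost regular: the image $P_C^{[0]}:=\mathcal L(P_L)$ (the primary constraint submanifold) is an embedded submanifold of $P_C$ of some fixed codimension, $\mathcal L$ is a submersion onto it, and every preimage $\mathcal L^{-1}(s)$, $s\in P_C^{[0]}$, is connected. Let $\Gamma(\mathcal G)$ be the space of smooth vector fields on $P_L$ with values in $\mathcal G$, and let $$\overline{TP_L}=\{X \text{ a smooth vector field on } P_L : [X,G]\in\Gamma(\mathcal G)\ \text{ for all } G\in\Gamma(\mathcal G)\}.$$ A vector field $X$ on $P_L$ is called projectable if for each $s\in P_C^{[0]}$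 the set $\mathcal L_*X(s)=\{d\mathcal L_u(X(u)) : \mathcal L(u)=s\}$ consists of a single vector of $T_sP_C$. Then: 1. $\Gamma(\mathcal G)\subset\overline{TP_L}$. 2. Every $X\in\overline{TP_L}$ is projectable; conversely, every projectable smooth vector field on $P_L$ belongs to $\overline{TP_L}$. 3. For $X\in\overline{TP_L}$ the projection $\mathcal L_*X$ is a vector field along $P_C^{[0]}$ that is smooth. It depends linearly on $X$, and $X,Y\in\overline{TP_L}$ have the same projection if and only if $X-Y\in\Gamma(\mathcal G)$. Thus $\mathcal L_*$ is a well-defined injective linear map on the quotient $\overline{TP_L}/\Gamma(\mathcal G)$. 4. The classes push forward exactly onto the tangent spaces of the primary constraint submanifold: for every $s\in P_C^{[0]}$, $$\{(\mathcal L_*[X])(s) : [X]\in\overline{TP_L}/\Gamma(\mathcal G)\}=T_sP_C^{[0]} .$$ -/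

import Mathlib

open scoped Manifold ContDiff Topology

noncomputable section

namespace SingularLagrangian

/-! ### Vector fields and embedded submanifolds of a manifold -/

section General

variable {F H : Type*} [NormedAddCommGroup F] [NormedSpace ℝ F] [TopologicalSpace H]
  (I : ModelWithCorners ℝ F H) {M : Type*} [TopologicalSpace M] [ChartedSpace H M]

/-- A vector field on `M`, smooth at all points of the subset `S`. -/
def SmoothFieldOn [IsManifold I 1 M] (X : (x : M) → TangentSpace I x) (S : Set M) : Prop :=
  ContMDiffOn I I.tangent ∞ (fun x => (⟨x, X x⟩ : TangentBundle I M)) S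

/-- A (globally defined) smooth vector field on `M`. -/
def SmoothField [IsManifold I 1 M] (X : (x : M) → TangentSpace I x) : Prop :=
  ContMDiff I I.tangent ∞ (fun x => (⟨x, X x⟩ : TangentBundle I M))

/-- `S` is an embedded submanifold of codimension `k`: near each of its points it is the common
zero set of `k` smooth functions with linearly independent differentials. -/
def IsEmbeddedSubmanifold (k : ℕ) (S : Set M) : Prop :=
  ∀ s ∈ S, ∃ W : Set M, IsOpen W ∧ s ∈ W ∧ ∃ γ : M → (Fin k → ℝ),
    ContMDiffOn I 𝓘(ℝ, Fin k → ℝ) ∞ γ W ∧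
    (∀ x ∈ W, Function.Surjective (mfderiv I 𝓘(ℝ, Fin k → ℝ) γ x)) ∧
    S ∩ W = {x ∈ W | γ x = 0}

/-- The tangent space `T_s S` of a submanifold `S ⊆ M`: the vectors of `T_s M` annihilated by the
differential at `s` of every constraint, that is, of every function that is smooth near `s` and
vanishes on `S` near `s`. -/
def tangentSpaceOf (S : Set M) (s : M) : Submodule ℝ (TangentSpace I s) where
  carrier := {w | ∀ f : M → ℝ, ContMDiffAt I 𝓘(ℝ, ℝ) ∞ f s → (∀ᶠ x in 𝓝[S] s, f x = 0) →
    mfderiv I 𝓘(ℝ, ℝ) f s w = 0}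
  add_mem' := by
    intro a b ha hb f hf h0
    rw [map_add, ha f hf h0, hb f hf h0]
    exact add_zero _
  zero_mem' := by
    intro f _ _
    exact map_zero _
  smul_mem' := by
    intro c a ha f hf h0
    rw [map_smul, ha f hf h0]
    exact smul_zero _

end General

/-! ### The two phase spaces and the fibre derivative -/

variable (E : Type*) [NormedAddCommGroup E] [NormedSpace ℝ E]
  (Q : Type*) [TopologicalSpace Q] [ChartedSpace E Q] [IsManifold 𝓘(ℝ, E) ∞ Q]

/-- The Lagrangian (velocity) phase space `P_L = TQ`. -/
abbrev PL : Type _ := TangentBundle 𝓘(ℝ, E) Q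

/-- The canonical phase space `P_C = T*Q`. -/
abbrev PC : Type _ :=
  Bundle.TotalSpace (E →L[ℝ] ℝ)
    (fun q : Q => TangentSpace 𝓘(ℝ, E) q →L[ℝ] Bundle.Trivial Q ℝ q)

/-- The model of `P_L`. -/
abbrev IL : ModelWithCorners ℝ (E × E) (ModelProd E E) := 𝓘(ℝ, E).tangent

/-- The model of `P_C`. -/
abbrev IC : ModelWithCorners ℝ (E × (E →L[ℝ] ℝ)) (ModelProd E (E →L[ℝ] ℝ)) :=
  𝓘(ℝ, E).prod 𝓘(ℝ, E →L[ℝ] ℝ)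

variable {E Q}

/-- The restriction of the Lagrangian to the fibre `T_q Q` (whose underlying vector space is the
model space `E`). -/
def fibreRestriction (L : PL E Q → ℝ) (q : Q) : E → ℝ := fun v => L ⟨q, v⟩

/-- The fibre derivative (Legendre transform) `𝓛 : P_L → P_C`, `(q, v) ↦ (q, ∂L/∂v)`. -/
def fibreDeriv (L : PL E Q → ℝ) (u : PL E Q) : PC E Q :=
  ⟨u.proj, (fderiv ℝ (fibreRestriction L u.proj) (u.snd : E) : E →L[ℝ] ℝ)⟩

/-- The Hessian `M = ∂²L/∂v∂v` at `u = (q, v)`, a bilinear form on `T_q Q`. -/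
def hessian (L : PL E Q → ℝ) (u : PL E Q) : E →L[ℝ] E →L[ℝ] ℝ :=
  fderiv ℝ (fderiv ℝ (fibreRestriction L u.proj)) (u.snd : E)

/-- The vertical lift `z ↦ z · ∂/∂v` from `T_q Q` to the vertical vectors at `u = (q, v)`: the
derivative of the inclusion of the fibre `T_q Q` into `TQ`. -/
def verticalLift (u : PL E Q) : E →L[ℝ] TangentSpace (IL E) u :=
  mfderiv 𝓘(ℝ, E) (IL E) (fun v : E => (⟨u.proj, v⟩ : PL E Q)) u.snd

/-- The vertical kernel distribution `𝓖`: at `u` it is the space of the vertical vectors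
`z · ∂/∂v` with `M_{ab}(u) z^b = 0`. -/
def verticalKernel (L : PL E Q → ℝ) (u : PL E Q) : Submodule ℝ (TangentSpace (IL E) u) :=
  (LinearMap.ker (hessian L u).toLinearMap).map (verticalLift u).toLinearMap

/-- The primary constraint submanifold `P_C^{[0]} = 𝓛(P_L)`. -/
def primaryConstraintSet (L : PL E Q → ℝ) : Set (PC E Q) := Set.range (fibreDeriv L)

/-- Almost regular Lagrangians: the image of the fibre derivative is an embedded submanifold of
`P_C`, the fibre derivative is a submersion onto it, and the preimages of its points are
connected. -/
structure IsAlmostRegular (L : PL E Q → ℝ) : Prop where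
  smooth : ContMDiff (IL E) 𝓘(ℝ, ℝ) ∞ L
  image_submanifold : ∃ k : ℕ, IsEmbeddedSubmanifold (IC E) k (primaryConstraintSet L)
  submersive : ∀ u : PL E Q,
    tangentSpaceOf (IC E) (primaryConstraintSet L) (fibreDeriv L u) ≤
      LinearMap.range (mfderiv (IL E) (IC E) (fibreDeriv L) u).toLinearMap
  connected_fibres : ∀ s ∈ primaryConstraintSet L, IsConnected (fibreDeriv L ⁻¹' {s})

/-! ### Vector fields on `P_L` and their projection -/

/-- The smooth vector fields on `P_L` that lie in `𝓖`. -/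
def kernelFields (L : PL E Q → ℝ) : Submodule ℝ ((u : PL E Q) → TangentSpace (IL E) u) where
  carrier := {G | SmoothField (IL E) G ∧ ∀ u, G u ∈ verticalKernel L u}
  add_mem' := fun ha hb => ⟨ha.1.add_section hb.1, fun u => add_mem (ha.2 u) (hb.2 u)⟩
  zero_mem' := ⟨Bundle.contMDiff_zeroSection ℝ _, fun _ => zero_mem _⟩
  smul_mem' := fun c _ ha => ⟨ha.1.const_smul_section (a := c),
    fun u => Submodule.smul_mem _ c (ha.2 u)⟩

/-- The smooth vector fields `X` on `P_L` with `[X, G] ∈ 𝓖` for every vector field `G` in `𝓖`. -/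
def idealFields [FiniteDimensional ℝ E] (L : PL E Q → ℝ) : Submodule ℝ ((u : PL E Q) → TangentSpace (IL E) u) where
  carrier := {X | SmoothField (IL E) X ∧
    ∀ G ∈ kernelFields L, ∀ u, VectorField.mlieBracket (IL E) X G u ∈ verticalKernel L u}
  add_mem' := by
    intro X Y hX hY
    have : CompleteSpace (E × E) := FiniteDimensional.complete ℝ (E × E)
    refine ⟨hX.1.add_section hY.1, fun G hG u => ?_⟩
    rw [VectorField.mlieBracket_add_left ((hX.1 u).mdifferentiableAt (by simp))
      ((hY.1 u).mdifferentiableAt (by simp))]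
    exact add_mem (hX.2 G hG u) (hY.2 G hG u)
  zero_mem' := by
    refine ⟨Bundle.contMDiff_zeroSection ℝ _, fun G hG u => ?_⟩
    rw [VectorField.mlieBracket_zero_left]
    exact zero_mem _
  smul_mem' := by
    intro c X hX
    have : CompleteSpace (E × E) := FiniteDimensional.complete ℝ (E × E)
    refine ⟨hX.1.const_smul_section (a := c), fun G hG u => ?_⟩
    rw [VectorField.mlieBracket_const_smul_left ((hX.1 u).mdifferentiableAt (by simp))]
    exact Submodule.smul_mem _ c (hX.2 G hG u)

/-- The quotient of the fields for which `𝓖` is an ideal by the fields in `𝓖`. -/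
abbrev IdealFieldsModKernel [FiniteDimensional ℝ E] (L : PL E Q → ℝ) : Type _ :=
  idealFields L ⧸ (kernelFields L).submoduleOf (idealFields L)

/-- The pushforward `𝓛_* X (s) = {d𝓛_u (X u) | 𝓛 u = s}`, a set of tangent vectors of `P_C`
at `s`. -/
def pushforward (L : PL E Q → ℝ) (X : (u : PL E Q) → TangentSpace (IL E) u) (s : PC E Q) :
    Set (TangentBundle (IC E) (PC E Q)) :=
  {w | ∃ u : PL E Q, fibreDeriv L u = s ∧
    w = tangentMap (IL E) (IC E) (fibreDeriv L) ⟨u, X u⟩}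

/-- A vector field `X` on `P_L` is projectable if its pushforward is single valued at each point
of the image of `𝓛`. -/
def IsProjectable (L : PL E Q → ℝ) (X : (u : PL E Q) → TangentSpace (IL E) u) : Prop :=
  ∀ s ∈ primaryConstraintSet L, ∃ w : TangentSpace (IC E) s, pushforward L X s = {⟨s, w⟩}

end SingularLagrangian

end

/-! Two facts carry the theorem: $\ker d\mathcal L=\mathcal G$, and a general statement on smooth
maps $f:M\to B$ that are submersions onto an embedded image.

For the first, $\mathcal L$ covers the identity of $Q$, so a vector killed by $d\mathcal L$ is
vertical, and on vertical vectors $d\mathcal L$ is the Hessian followed by an injective map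
(`mfderiv_fibreDeriv_eq_zero_iff`). Everything after that uses only $f=\mathcal L$ and $\ker df$.

The tool for the second is a local trivialization $\sigma$: it inverts
$x\mapsto(f(x),\text{chart}(x))$ near $u$, and each $\sigma(\cdot,\tau)$ is a section of $f$ over
the image. The slices $\tau\mapsto\sigma(f(u),\tau)$ stay in the fibre and cover it near $u$.

Let $h$ be $f$ read in a chart of $B$, and let $G$ be a field in $\ker df$. Then $Gh=0$, so
$[X,G]h=X(Gh)-G(Xh)=-G(Xh)$. Hence $[X,G]$ lies in $\ker df$ exactly when $Xh$, which is $df(X)$ in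
the chart, has zero derivative along $G$. Every kernel vector extends to a global kernel field, so
if all these brackets are vertical then $Xh$ is constant on slices, $df(X)$ is locally constant on
fibres, and connectedness makes it constant. Conversely, a projectable $X$ has $Xh$ constant on
slices, to which $G$ is tangent.

Smoothness of the projection follows by composing $df(X)$ with a smooth local section. For
surjectivity onto $T_sP_C^{[0]}$, extend a vector to a local field on $B$ along the image, cut it
off, and lift it: the condition on a lift is affine in each tangent space, so local lifts glue by a
partition of unity. -/

/-! ### Submersions onto a zero set in normed spaces -/

section LocalCoordinates

variable {A V : Type*} [NormedAddCommGroup A] [NormedSpace ℝ A]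
  [NormedAddCommGroup V] [NormedSpace ℝ V]

/-- A strictly differentiable map is injective near a point along a subspace on which its
derivative is injective. -/
theorem HasStrictFDerivAt.eventually_injective_of_disjoint [FiniteDimensional ℝ A]
    {f : A → V} {f' : A →L[ℝ] V} {a : A}
    (hf : HasStrictFDerivAt f f' a) {C : Submodule ℝ A}
    (hC : Disjoint C (LinearMap.ker f'.toLinearMap)) :
    ∀ᶠ p in 𝓝 (a, a), p.1 - p.2 ∈ C → f p.1 = f p.2 → p.1 = p.2 := by
  have hker : LinearMap.ker (f'.toLinearMap.domRestrict C) = ⊥ := by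
    rw [LinearMap.ker_eq_bot']
    intro x hx
    have := Submodule.disjoint_def.1 hC x x.2 hx
    exact Subtype.ext this
  obtain ⟨K, hK, hanti⟩ := LinearMap.exists_antilipschitzWith _ hker
  have hK' : (0 : ℝ) < K := hK
  -- With this constant, `K` times the linearization error is at most half of `‖p.1 - p.2‖`, which
  -- forces that norm to vanish.
  have ho := hf.isLittleO.def (c := 1 / (2 * K)) (by positivity)
  filter_upwards [ho] with p hp hpC hfp
  have h1 : ‖p.1 - p.2‖ ≤ K * ‖f' (p.1 - p.2)‖ := by
    have := hanti.le_mul_dist ⟨p.1 - p.2, hpC⟩ 0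
    simpa using this
  rw [hfp, sub_self, zero_sub, norm_neg] at hp
  have h2 : K * ‖f' (p.1 - p.2)‖ ≤ 1 / 2 * ‖p.1 - p.2‖ := by
    calc K * ‖f' (p.1 - p.2)‖ ≤ K * (1 / (2 * K) * ‖p.1 - p.2‖) := by gcongr
      _ = 1 / 2 * ‖p.1 - p.2‖ := by field_simp
  have h3 : ‖p.1 - p.2‖ = 0 := le_antisymm (by linarith) (norm_nonneg _)
  exact sub_eq_zero.1 (norm_eq_zero.1 h3)

/-- A vector annihilated by a surjective differential `γ'` is annihilated by the differential of
every function that vanishes on the level set of `γ`. -/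
theorem HasStrictFDerivAt.apply_eq_zero_of_eventually_eq_zero [CompleteSpace A]
    [CompleteSpace V] {γ : A → V} {γ' : A →L[ℝ] V} {h : A → ℝ} {h' : A →L[ℝ] ℝ} {a : A}
    (hγ : HasStrictFDerivAt γ γ' a) (hsurj : Function.Surjective γ')
    (hh : HasStrictFDerivAt h h' a) (h0 : ∀ᶠ x in 𝓝[{x | γ x = γ a}] a, h x = 0)
    {w : A} (hw : γ' w = 0) : h' w = 0 := by
  have ha : h a = 0 := h0.self_of_nhdsWithin rfl
  -- Being zero on the level set, `h` trivially has a constrained extremum at `a`. Lagrange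
  -- multipliers then make `h'` factor through `γ'`, because surjectivity of `γ'` rules out a zero
  -- multiplier of `h'`.
  have hext : IsLocalExtrOn h {x | γ x = γ a} a :=
    Or.inl (h0.mono fun x hx => by rw [hx, ha])
  obtain ⟨Λ, Λ₀, hne, hΛ⟩ := hext.exists_linear_map_of_hasStrictFDerivAt hγ hh
  have hΛ₀ : Λ₀ ≠ 0 := by
    rintro rfl
    apply hne
    have : Λ = 0 := by
      ext y
      obtain ⟨x, rfl⟩ := hsurj y
      simpa using hΛ x
    rw [this]; rfl
  simpa [hw, hΛ₀] using hΛ w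

/-- Let the values of `φ` lie in the zero set of `γ`, and let the range of the differential of `φ`
contain the kernel of the differential of `γ`. Then near each point `φ` is, up to a change of
coordinates, a projection onto the zero set. -/
theorem ContDiffAt.exists_local_trivialization {F F' V : Type*}
    [NormedAddCommGroup F] [NormedSpace ℝ F] [FiniteDimensional ℝ F]
    [NormedAddCommGroup F'] [NormedSpace ℝ F'] [FiniteDimensional ℝ F']
    [NormedAddCommGroup V] [NormedSpace ℝ V]
    {φ : F → F'} {γ : F' → V} {a : F}
    (hφn : ∀ᶠ x in 𝓝 a, ContDiffAt ℝ ∞ φ x) (hγ : ContDiffAt ℝ ∞ γ (φ a))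
    (h0 : ∀ᶠ x in 𝓝 a, γ (φ x) = 0)
    (hker : LinearMap.ker (fderiv ℝ γ (φ a)).toLinearMap ≤
      LinearMap.range (fderiv ℝ φ a).toLinearMap) :
    ∃ σ : F' × F → F, (∀ᶠ p in 𝓝 (φ a, a), ContDiffAt ℝ ∞ σ p) ∧ σ (φ a, a) = a ∧
      (∀ᶠ p in 𝓝 (φ a, a), γ p.1 = 0 → φ (σ p) = p.1) ∧
      ∀ᶠ x in 𝓝 a, σ (φ x, x) = x := by
  have hcF : CompleteSpace F := FiniteDimensional.complete ℝ F
  have hcF' : CompleteSpace F' := FiniteDimensional.complete ℝ F'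
  have hφ : ContDiffAt ℝ ∞ φ a := hφn.self_of_nhds
  set D := fderiv ℝ φ a with hD
  set K : Submodule ℝ F := LinearMap.ker D.toLinearMap with hK
  obtain ⟨C, hC⟩ := Submodule.exists_isCompl (LinearMap.range D.toLinearMap)
  obtain ⟨K', hK'⟩ := Submodule.exists_isCompl K
  let P : F →L[ℝ] K := (Submodule.projectionOnto K K' hK').toContinuousLinearMap
  have hP : ∀ x : K, P x = x := fun x => Submodule.projectionOnto_apply_left hK' x
  -- Adding a complement `C` of the range and recording the kernel component turns `φ` into a local
  -- diffeomorphism. The map `σ (p, x)` is then the first component of its inverse at `(p, P x)`.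
  let T : F × C → F' × K := fun z => (φ z.1 + z.2, P z.1)
  let T' : (F × C) →L[ℝ] (F' × K) :=
    (D.comp (ContinuousLinearMap.fst ℝ F C) +
      C.subtypeL.comp (ContinuousLinearMap.snd ℝ F C)).prod
      (P.comp (ContinuousLinearMap.fst ℝ F C))
  have hcC : CompleteSpace C := FiniteDimensional.complete ℝ C
  have hcK : CompleteSpace K := FiniteDimensional.complete ℝ K
  have hTn : ∀ z : F × C, ContDiffAt ℝ ∞ φ z.1 → ContDiffAt ℝ ∞ T z := by
    intro z hz
    refine ContDiffAt.prodMk (ContDiffAt.add ?_ ?_) ?_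
    · exact ContDiffAt.comp z (g := φ) hz contDiffAt_fst
    · exact C.subtypeL.contDiff.contDiffAt.comp z contDiffAt_snd
    · exact P.contDiff.contDiffAt.comp z contDiffAt_fst
  have hT : ContDiffAt ℝ ∞ T (a, 0) := hTn _ hφ
  have hT' : HasFDerivAt T T' (a, 0) := by
    have hφ' : HasFDerivAt φ D a := (hφ.differentiableAt (by simp)).hasFDerivAt
    refine HasFDerivAt.prodMk (HasFDerivAt.add ?_ ?_) ?_
    · exact HasFDerivAt.comp (a, (0 : C)) (g := φ) hφ' hasFDerivAt_fst
    · exact C.subtypeL.hasFDerivAt.comp (a, (0 : C)) hasFDerivAt_snd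
    · exact P.hasFDerivAt.comp (a, (0 : C)) hasFDerivAt_fst
  have hinj : LinearMap.ker T'.toLinearMap = ⊥ := by
    rw [LinearMap.ker_eq_bot']
    rintro ⟨x, ρ⟩ h
    have h1 : D x + ρ = 0 := congrArg Prod.fst h
    have h2 : P x = 0 := congrArg Prod.snd h
    have h3 : D x = 0 := by
      refine Submodule.disjoint_def.1 hC.disjoint _ ⟨x, rfl⟩ ?_
      rw [eq_neg_of_add_eq_zero_left h1]
      exact neg_mem ρ.2
    have h4 : x = 0 := by
      have := hP ⟨x, h3⟩
      rw [h2] at this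
      exact (congrArg Subtype.val this).symm
    rw [h3, zero_add] at h1
    have h5 : ρ = 0 := Subtype.ext h1
    rw [h4, h5]; rfl
  have hsurj : LinearMap.range T'.toLinearMap = ⊤ := by
    rw [LinearMap.range_eq_top]
    rintro ⟨y, k⟩
    obtain ⟨_, ⟨x, rfl⟩, ρ, hρ, rfl⟩ : ∃ u ∈ LinearMap.range D.toLinearMap, ∃ c ∈ C, u + c = y :=
      Submodule.mem_sup.1 (hC.sup_eq_top ▸ Submodule.mem_top)
    refine ⟨(x - P x + k, ⟨ρ, hρ⟩), ?_⟩
    have h1 : D (P x : F) = 0 := (P x).2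
    have h2 : D (k : F) = 0 := k.2
    refine Prod.ext ?_ ?_
    · show D (x - P x + k) + ρ = D x + ρ
      rw [map_add, map_sub, h1, h2, sub_zero, add_zero]
    · show P (x - P x + k) = k
      rw [map_add, map_sub, hP, hP, sub_self, zero_add]
  let e : (F × C) ≃L[ℝ] (F' × K) := ContinuousLinearEquiv.ofBijective T' hinj hsurj
  have he : HasFDerivAt T (e : (F × C) →L[ℝ] (F' × K)) (a, 0) := by
    rwa [ContinuousLinearEquiv.coe_ofBijective]
  have hn : (∞ : WithTop ℕ∞) ≠ 0 := by simp
  let S := hT.localInverse he hn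
  have hS : ContDiffAt ℝ ∞ S (T (a, 0)) := hT.to_localInverse he hn
  -- Being `ContDiffAt ℝ ∞` at one point does not give `C^∞` on a neighbourhood. Smoothness of the
  -- inverse at nearby points comes from applying the inverse function theorem there, since
  -- invertibility of the derivative is an open condition.
  have hinv : ∀ᶠ z in 𝓝 (a, (0 : C)), ContDiffAt ℝ ∞ T z ∧
      ∃ e' : (F × C) ≃L[ℝ] (F' × K), HasFDerivAt T (e' : (F × C) →L[ℝ] (F' × K)) z := by
    have hc : ContinuousAt (fderiv ℝ T) (a, 0) :=
      (hT.fderiv_right (m := 0) (by simp)).continuousAt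
    have h1 : ∀ᶠ z in 𝓝 (a, (0 : C)), fderiv ℝ T z ∈
        Set.range ((↑) : ((F × C) ≃L[ℝ] (F' × K)) → ((F × C) →L[ℝ] (F' × K))) := by
      refine hc.eventually ?_
      rw [he.fderiv]
      exact e.nhds
    filter_upwards [(continuous_fst.tendsto (a, (0 : C))).eventually hφn, h1] with z hz1 hz2
    refine ⟨hTn z hz1, ?_⟩
    obtain ⟨e', he'⟩ := hz2
    refine ⟨e', ?_⟩
    rw [he']
    exact ((hTn z hz1).differentiableAt hn).hasFDerivAt
  have hSn : ∀ᶠ y in 𝓝 (T (a, 0)), ContDiffAt ℝ ∞ S y := by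
    have hSt : Filter.Tendsto S (𝓝 (T (a, 0))) (𝓝 (a, 0)) := by
      have := hS.continuousAt.tendsto
      rwa [show S (T (a, 0)) = (a, 0) from hT.localInverse_apply_image he hn] at this
    filter_upwards [hSt.eventually hinv, (hT.toOpenPartialHomeomorph T he hn).open_target.mem_nhds
      (hT.image_mem_toOpenPartialHomeomorph_target he hn)] with y hy1 hy2
    obtain ⟨hy3, e', he'⟩ := hy1
    exact (hT.toOpenPartialHomeomorph T he hn).contDiffAt_symm hy2 he' hy3
  have hSa : S (T (a, 0)) = (a, 0) := hT.localInverse_apply_image he hn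
  have hstrict := hT.hasStrictFDerivAt' he hn
  have hl : ∀ᶠ z in 𝓝 (a, (0 : C)), S (T z) = z := hstrict.eventually_left_inverse
  have hr : ∀ᶠ y in 𝓝 (T (a, 0)), T (S y) = y := hstrict.eventually_right_inverse
  have hTa : T (a, 0) = (φ a, P a) := by simp [T]
  rw [hTa] at hS hSa hr hSn
  let m : F' × F → F' × K := fun p => (p.1, P p.2)
  have hm : ContDiff ℝ ∞ m := contDiff_fst.prodMk (P.contDiff.comp contDiff_snd)
  have hσ : ContDiffAt ℝ ∞ (fun p => S (m p)) (φ a, a) :=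
    ContDiffAt.comp (φ a, a) (g := S) hS hm.contDiffAt
  -- For `p.1` in the zero set, `p.1` and `φ (σ p)` are both zeros of `γ` and differ by an element
  -- of `C`. Since `C` misses the kernel of the differential of `γ`, they coincide near the base
  -- point.
  have hdisj : Disjoint C (LinearMap.ker (fderiv ℝ γ (φ a)).toLinearMap) :=
    (hC.disjoint.mono_left hker).symm
  have hγinj := (hγ.hasStrictFDerivAt hn).eventually_injective_of_disjoint hdisj
  have htend : Filter.Tendsto (fun p : F' × F => (S (m p)).1) (𝓝 (φ a, a)) (𝓝 a) := by
    have := (hσ.fst).continuousAt.tendsto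
    simpa [m, hSa] using this
  have htend2 : Filter.Tendsto (fun p : F' × F => (p.1, φ (S (m p)).1)) (𝓝 (φ a, a))
      (𝓝 (φ a, φ a)) :=
    (continuous_fst.tendsto' _ _ rfl).prodMk_nhds (hφ.continuousAt.tendsto.comp htend)
  refine ⟨fun p => (S (m p)).1, ?_, by simp [m, hSa], ?_, ?_⟩
  · filter_upwards [(hm.continuous.tendsto (φ a, a)).eventually hSn] with p hp
    exact (ContDiffAt.comp p (g := S) hp hm.contDiffAt).fst
  · filter_upwards [htend2.eventually hγinj, htend.eventually h0,
      (hm.continuous.tendsto (φ a, a)).eventually hr] with p h1 h2 h3 hp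
    have h4 : φ (S (m p)).1 + (S (m p)).2 = p.1 := congrArg Prod.fst h3
    refine (h1 ?_ ?_).symm
    · show p.1 - φ (S (m p)).1 ∈ C
      rw [← h4, add_sub_cancel_left]
      exact (S (m p)).2.2
    · show γ p.1 = γ (φ (S (m p)).1)
      rw [hp, h2]
  · have ht : Filter.Tendsto (fun x : F => (x, (0 : C))) (𝓝 a) (𝓝 (a, 0)) :=
      (by fun_prop : Continuous fun x : F => (x, (0 : C))).tendsto a
    filter_upwards [ht.eventually hl] with x hx
    have : m (φ x, x) = T (x, 0) := by simp [m, T]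
    show (S (m (φ x, x))).1 = x
    rw [this, hx]

end LocalCoordinates

/-! ### Local trivializations on manifolds -/

namespace SingularLagrangian

section Manifolds

variable {F H : Type*} [NormedAddCommGroup F] [NormedSpace ℝ F]
  [TopologicalSpace H] {I : ModelWithCorners ℝ F H} [I.Boundaryless]
  {M : Type*} [TopologicalSpace M] [ChartedSpace H M] [IsManifold I ∞ M]
  {F' H' : Type*} [NormedAddCommGroup F'] [NormedSpace ℝ F']
  [TopologicalSpace H'] {I' : ModelWithCorners ℝ F' H'} [I'.Boundaryless]
  {B : Type*} [TopologicalSpace B] [ChartedSpace H' B] [IsManifold I' ∞ B]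

omit [IsManifold I ∞ M] [I'.Boundaryless] [IsManifold I' ∞ B] in
theorem mfderiv_eq_fderiv_writtenInExtChartAt {f : M → B} {u : M}
    (hf : MDifferentiableAt I I' f u) :
    mfderiv I I' f u = fderiv ℝ (writtenInExtChartAt I I' u f) (extChartAt I u u) := by
  rw [hf.mfderiv, ModelWithCorners.range_eq_univ, fderivWithin_univ]

omit [IsManifold I ∞ M] [I'.Boundaryless] [IsManifold I' ∞ B] in
theorem contDiffAt_writtenInExtChartAt {f : M → B} {u : M}
    (hf : ContMDiffAt I I' ∞ f u) :
    ContDiffAt ℝ ∞ (writtenInExtChartAt I I' u f) (extChartAt I u u) := by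
  have := (contMDiffAt_iff.1 hf).2
  rwa [ModelWithCorners.range_eq_univ, contDiffWithinAt_univ] at this

/-- Transports `ContDiffAt.exists_local_trivialization` through charts at `u` and `f u`. Smoothness
of `σ` is asserted on a neighbourhood so that `σ` can be differentiated at points other than the
centre. -/
theorem exists_local_trivialization [FiniteDimensional ℝ F] [FiniteDimensional ℝ F']
    {f : M → B} (hf : ContMDiff I I' ∞ f) {k : ℕ}
    (hemb : IsEmbeddedSubmanifold I' k (Set.range f)) (u : M)
    (hsub : tangentSpaceOf I' (Set.range f) (f u) ≤
      LinearMap.range (mfderiv I I' f u).toLinearMap) :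
    ∃ σ : B × F → M,
      (∀ᶠ p in 𝓝 (f u, extChartAt I u u), ContMDiffAt (I'.prod 𝓘(ℝ, F)) I ∞ σ p) ∧
      σ (f u, extChartAt I u u) = u ∧
      (∀ᶠ p in 𝓝 (f u, extChartAt I u u), p.1 ∈ Set.range f → f (σ p) = p.1) ∧
      ∀ᶠ x in 𝓝 u, σ (f x, extChartAt I u x) = x := by
  have hcF' : CompleteSpace F' := FiniteDimensional.complete ℝ F'
  obtain ⟨W, hWo, hsW, γ, hγ, hγs, hγ0⟩ := hemb (f u) ⟨u, rfl⟩
  set φ := writtenInExtChartAt I I' u f with hφdef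
  set a := extChartAt I u u with ha
  have hφa : φ a = extChartAt I' (f u) (f u) := by simp [φ, a, writtenInExtChartAt]
  set γ' : F' → (Fin k → ℝ) := γ ∘ (extChartAt I' (f u)).symm with hγ'
  have hW : W ∈ 𝓝 (f u) := hWo.mem_nhds hsW
  have hγat : ContMDiffAt I' 𝓘(ℝ, Fin k → ℝ) ∞ γ (f u) := hγ.contMDiffAt hW
  have hφs : ContDiffAt ℝ ∞ φ a := contDiffAt_writtenInExtChartAt hf.contMDiffAt
  have hφsn : ∀ᶠ x in 𝓝 a, ContDiffAt ℝ ∞ φ x := by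
    have hcont : ContinuousAt (fun x => f ((extChartAt I u).symm x)) a :=
      hf.continuous.continuousAt.comp (continuousAt_extChartAt_symm u)
    have h1 := hcont.tendsto.eventually (extChartAt_source_mem_nhds (I := I') _)
    rw [show (extChartAt I u).symm a = u from extChartAt_to_inv u] at h1
    filter_upwards [h1.eventually_nhds, (isOpen_extChartAt_target u).mem_nhds
      (mem_extChartAt_target (I := I) u)] with x hx1 hx2
    refine ContMDiffAt.contDiffAt ?_
    have h2 : ContMDiffAt 𝓘(ℝ, F) I ∞ (extChartAt I u).symm x :=
      (contMDiffOn_extChartAt_symm u).contMDiffAt ((isOpen_extChartAt_target u).mem_nhds hx2)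
    exact (contMDiffAt_extChartAt' (by
      rw [← extChartAt_source I']; exact hx1.self_of_nhds)).comp x (hf.contMDiffAt.comp x h2)
  have hγs' : ContDiffAt ℝ ∞ γ' (φ a) := by
    rw [hφa]; exact contDiffAt_writtenInExtChartAt hγat
  have hn : (∞ : WithTop ℕ∞) ≠ 0 := by simp
  have hγd : mfderiv I' 𝓘(ℝ, Fin k → ℝ) γ (f u) = fderiv ℝ γ' (φ a) := by
    rw [hφa]; exact mfderiv_eq_fderiv_writtenInExtChartAt (hγat.mdifferentiableAt hn)
  have hfd : mfderiv I I' f u = fderiv ℝ φ a :=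
    mfderiv_eq_fderiv_writtenInExtChartAt (hf.contMDiffAt.mdifferentiableAt hn)
  have hsymm : Filter.Tendsto (extChartAt I' (f u)).symm (𝓝 (φ a)) (𝓝 (f u)) := by
    have := (continuousAt_extChartAt_symm (I := I') (f u)).tendsto
    rwa [extChartAt_to_inv, ← hφa] at this
  have hsymm2 : Filter.Tendsto (extChartAt I u).symm (𝓝 a) (𝓝 u) := by
    have := (continuousAt_extChartAt_symm (I := I) u).tendsto
    rwa [extChartAt_to_inv] at this
  have hγu : γ (f u) = 0 := by
    have : f u ∈ {x ∈ W | γ x = 0} := hγ0 ▸ ⟨⟨u, rfl⟩, hsW⟩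
    exact this.2
  have hγfa : γ' (φ a) = 0 := by
    rw [hφa]; simpa [γ'] using hγu
  have h0 : ∀ᶠ x in 𝓝 a, γ' (φ x) = 0 := by
    have h1 : ∀ᶠ x in 𝓝 a, f ((extChartAt I u).symm x) ∈ W :=
      (hf.continuous.continuousAt.tendsto.comp hsymm2).eventually hW
    have h2 : ∀ᶠ x in 𝓝 a, f ((extChartAt I u).symm x) ∈ (extChartAt I' (f u)).source :=
      (hf.continuous.continuousAt.tendsto.comp hsymm2).eventually
        (extChartAt_source_mem_nhds (f u))
    filter_upwards [h1, h2] with x hx1 hx2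
    have h3 : f ((extChartAt I u).symm x) ∈ {x ∈ W | γ x = 0} := hγ0 ▸ ⟨⟨_, rfl⟩, hx1⟩
    have h4 : (extChartAt I' (f u)).symm (φ x) = f ((extChartAt I u).symm x) :=
      (extChartAt I' (f u)).left_inv hx2
    show γ ((extChartAt I' (f u)).symm (φ x)) = 0
    rw [h4]; exact h3.2
  have hker : LinearMap.ker (fderiv ℝ γ' (φ a)).toLinearMap ≤
      LinearMap.range (fderiv ℝ φ a).toLinearMap := by
    intro v hv
    rw [hfd] at hsub
    refine hsub ?_
    -- `tangentSpaceOf` tests against every constraint `h`, while only `γ` is known to kill the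
    -- vector; the multiplier argument bridges the two.
    intro h hh hh0
    rw [mfderiv_eq_fderiv_writtenInExtChartAt (hh.mdifferentiableAt hn)]
    have hhs : ContDiffAt ℝ ∞ (writtenInExtChartAt I' 𝓘(ℝ, ℝ) (f u) h) (φ a) := by
      rw [hφa]; exact contDiffAt_writtenInExtChartAt hh
    have hsu : Function.Surjective (fderiv ℝ γ' (φ a)) := by
      rw [← hγd]; exact hγs _ hsW
    have key := (hγs'.hasStrictFDerivAt hn).apply_eq_zero_of_eventually_eq_zero hsu
      (hhs.hasStrictFDerivAt hn) ?_ hv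
    · rw [hφa] at key; exact key
    · have h1 : ∀ᶠ y in 𝓝 (φ a), (extChartAt I' (f u)).symm y ∈ Set.range f →
          h ((extChartAt I' (f u)).symm y) = 0 :=
        hsymm.eventually (eventually_nhdsWithin_iff.1 hh0)
      filter_upwards [nhdsWithin_le_nhds h1, nhdsWithin_le_nhds (hsymm.eventually hW),
        self_mem_nhdsWithin] with y hy1 hy2 hy3
      have hmem : (extChartAt I' (f u)).symm y ∈ Set.range f ∩ W := by
        rw [hγ0]
        exact ⟨hy2, (hy3 : γ' y = γ' (φ a)).trans hγfa⟩
      exact hy1 hmem.1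
  obtain ⟨σ, hσ, hσa, hσ1, hσ2⟩ := ContDiffAt.exists_local_trivialization hφsn hγs' h0 hker
  rw [hφa] at hσ hσa hσ1
  let m : B × F → F' × F := fun p => (extChartAt I' (f u) p.1, p.2)
  have hm : ContMDiffAt (I'.prod 𝓘(ℝ, F)) 𝓘(ℝ, F' × F) ∞ m (f u, a) := by
    refine ContMDiffAt.prodMk_space ?_ contMDiffAt_snd
    exact (contMDiffAt_extChartAt (I := I') (x := f u)).comp (f u, a) contMDiffAt_fst
  have hσn := hσ
  replace hσ := hσ.self_of_nhds
  have hσm : ContMDiffAt (I'.prod 𝓘(ℝ, F)) 𝓘(ℝ, F) ∞ (σ ∘ m) (f u, a) :=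
    ContMDiffAt.comp (f u, a) (g := σ) hσ.contMDiffAt hm
  have hmt : Filter.Tendsto m (𝓝 (f u, a)) (𝓝 (extChartAt I' (f u) (f u), a)) :=
    hm.continuousAt.tendsto
  have hσt : Filter.Tendsto (σ ∘ m) (𝓝 (f u, a)) (𝓝 a) := by
    have h1 := hσm.continuousAt.tendsto
    have h2 : (σ ∘ m) (f u, a) = a := hσa
    rwa [h2] at h1
  refine ⟨fun p => (extChartAt I u).symm (σ (m p)), ?_, ?_, ?_, ?_⟩
  · filter_upwards [hmt.eventually hσn, hσt.eventually ((isOpen_extChartAt_target u).mem_nhds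
      (mem_extChartAt_target (I := I) u)), (continuous_fst.tendsto' (f u, a) (f u) rfl).eventually
      (extChartAt_source_mem_nhds (I := I') (f u))] with p hp1 hp2 hp3
    have h1 : ContMDiffAt (I'.prod 𝓘(ℝ, F)) 𝓘(ℝ, F' × F) ∞ m p := by
      refine ContMDiffAt.prodMk_space ?_ contMDiffAt_snd
      exact (contMDiffAt_extChartAt' (by rw [← extChartAt_source I']; exact hp3)).comp p
        contMDiffAt_fst
    have h2 : ContMDiffAt (I'.prod 𝓘(ℝ, F)) 𝓘(ℝ, F) ∞ (σ ∘ m) p :=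
      ContMDiffAt.comp p (g := σ) hp1.contMDiffAt h1
    exact ((contMDiffOn_extChartAt_symm u).contMDiffAt
      ((isOpen_extChartAt_target u).mem_nhds hp2)).comp p h2
  · show (extChartAt I u).symm (σ (extChartAt I' (f u) (f u), a)) = u
    rw [hσa]; exact extChartAt_to_inv u
  · have h2 : ∀ᶠ p in 𝓝 (f u, a), f ((extChartAt I u).symm (σ (m p))) ∈
        (extChartAt I' (f u)).source :=
      ((hf.continuous.continuousAt.tendsto.comp hsymm2).comp hσt).eventually
        (extChartAt_source_mem_nhds (f u))
    have h3 : ∀ᶠ p in 𝓝 (f u, a), p.1 ∈ (extChartAt I' (f u)).source :=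
      (continuous_fst.tendsto' (f u, a) (f u) rfl).eventually (extChartAt_source_mem_nhds (f u))
    have h4 : ∀ᶠ p in 𝓝 (f u, a), p.1 ∈ W :=
      (continuous_fst.tendsto' (f u, a) (f u) rfl).eventually hW
    filter_upwards [hmt.eventually hσ1, h2, h3, h4] with p hp1 hp2 hp3 hp4 hp
    have h5 : γ' (m p).1 = 0 := by
      have : p.1 ∈ {x ∈ W | γ x = 0} := hγ0 ▸ ⟨hp, hp4⟩
      show γ ((extChartAt I' (f u)).symm (extChartAt I' (f u) p.1)) = 0
      rw [(extChartAt I' (f u)).left_inv hp3]; exact this.2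
    exact (extChartAt I' (f u)).injOn hp2 hp3 (hp1 h5)
  · have h1 : ∀ᶠ x in 𝓝 u, σ (φ (extChartAt I u x), extChartAt I u x) = extChartAt I u x :=
      (continuousAt_extChartAt u).tendsto.eventually hσ2
    filter_upwards [h1, extChartAt_source_mem_nhds (I := I) u] with x hx1 hx2
    have h2 : φ (extChartAt I u x) = extChartAt I' (f u) (f x) := by
      show extChartAt I' (f u) (f ((extChartAt I u).symm (extChartAt I u x))) = _
      rw [(extChartAt I u).left_inv hx2]
    show (extChartAt I u).symm (σ (extChartAt I' (f u) (f x), extChartAt I u x)) = x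
    rw [← h2, hx1, (extChartAt I u).left_inv hx2]

end Manifolds

end SingularLagrangian

/-! ### The Lie bracket as a commutator of derivations -/

namespace SingularLagrangian

section Bracket

variable {F H : Type*} [NormedAddCommGroup F] [NormedSpace ℝ F]
  [TopologicalSpace H] {I : ModelWithCorners ℝ F H}
  {M : Type*} [TopologicalSpace M] [ChartedSpace H M] [IsManifold I ∞ M]
  {F' H' : Type*} [NormedAddCommGroup F'] [NormedSpace ℝ F']
  [TopologicalSpace H'] {I' : ModelWithCorners ℝ F' H'}
  {B : Type*} [TopologicalSpace B] [ChartedSpace H' B] [IsManifold I' ∞ B]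
  {G K : Type*} [NormedAddCommGroup G] [NormedSpace ℝ G]
  [TopologicalSpace K] {J : ModelWithCorners ℝ G K}
  {P : Type*} [TopologicalSpace P] [ChartedSpace K P]
  {N : Type*} [NormedAddCommGroup N] [NormedSpace ℝ N]

theorem contMDiffAt_tangentMap {f : M → B} {p : TangentBundle I M}
    (hf : ContMDiffAt I I' ∞ f p.proj) :
    ContMDiffAt I.tangent I'.tangent ∞ (tangentMap I I' f) p := by
  have hϕ : ContMDiffAt I.tangent 𝓘(ℝ, F →L[ℝ] F') ∞
      (fun y : TangentBundle I M => ContinuousLinearMap.inCoordinates F (TangentSpace I (M := M)) F'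
        (TangentSpace I' (M := B)) p.proj y.proj (f p.proj) (f y.proj) (mfderiv I I' f y.proj)) p :=
    ContMDiffAt.comp p (g := fun y : M =>
      ContinuousLinearMap.inCoordinates F (TangentSpace I (M := M)) F'
        (TangentSpace I' (M := B)) p.proj y (f p.proj) (f y) (mfderiv I I' f y))
      (hf.mfderiv_const (by simp)) (Bundle.contMDiffAt_proj (TangentSpace I))
  exact ContMDiffAt.clm_apply_of_inCoordinates (n := ∞) hϕ contMDiffAt_id
    (hf.comp p (Bundle.contMDiffAt_proj _))

theorem ContMDiffAt.tangentMap_comp {f : M → B} {g : P → TangentBundle I M} {x : P}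
    (hf : ContMDiffAt I I' ∞ f (g x).proj) (hg : ContMDiffAt J I.tangent ∞ g x) :
    ContMDiffAt J I'.tangent ∞ (fun y => tangentMap I I' f (g y)) x :=
  ContMDiffAt.comp x (contMDiffAt_tangentMap hf) hg

/-- The derivative of a vector valued function along a vector field. -/
noncomputable def dirDeriv (I : ModelWithCorners ℝ F H) (h : M → N)
    (V : (x : M) → TangentSpace I x) : M → N :=
  fun x => mfderiv I 𝓘(ℝ, N) h x (V x)

theorem contMDiffAt_dirDeriv {h : M → N} {V : (x : M) → TangentSpace I x} {u : M}
    (hh : ContMDiffAt I 𝓘(ℝ, N) ∞ h u)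
    (hV : ContMDiffAt I I.tangent ∞ (fun x => (⟨x, V x⟩ : TangentBundle I M)) u) :
    ContMDiffAt I 𝓘(ℝ, N) ∞ (dirDeriv I h V) u :=
  ContMDiffAt.comp u (contMDiff_snd_tangentBundle_modelSpace N 𝓘(ℝ, N)).contMDiffAt
    (ContMDiffAt.tangentMap_comp (I' := 𝓘(ℝ, N)) (g := fun x => (⟨x, V x⟩ : TangentBundle I M))
      hh hV)

/-- The terms containing the second derivative of `h` cancel by its symmetry. -/
theorem lieBracket_apply_eq_sub {h : F → N} {V W : F → F} {y : F}
    (hh : ContDiffAt ℝ ∞ h y) (hV : DifferentiableAt ℝ V y) (hW : DifferentiableAt ℝ W y) :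
    fderiv ℝ h y (VectorField.lieBracket ℝ V W y) =
      fderiv ℝ (fun x => fderiv ℝ h x (W x)) y (V y) -
        fderiv ℝ (fun x => fderiv ℝ h x (V x)) y (W y) := by
  have hd : DifferentiableAt ℝ (fderiv ℝ h) y :=
    (hh.fderiv_right (m := ∞) (by simp)).differentiableAt (by simp)
  have hsymm : IsSymmSndFDerivAt ℝ h y := by
    refine ContDiffAt.isSymmSndFDerivAt (n := ∞) hh ?_
    simp only [minSmoothness_of_isRCLikeNormedField]
    exact ENat.LEInfty.out
  rw [fderiv_clm_apply hd hW, fderiv_clm_apply hd hV, VectorField.lieBracket_eq]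
  have := hsymm (V y) (W y)
  simp [this]

/-- The Lie bracket is the commutator of the directional derivatives. -/
theorem dirDeriv_mlieBracket [CompleteSpace F] [I.Boundaryless] {h : M → N}
    {V W : (x : M) → TangentSpace I x} {u : M}
    (hh : ContMDiffAt I 𝓘(ℝ, N) ∞ h u) (hV : SmoothField I V) (hW : SmoothField I W) :
    dirDeriv I h (VectorField.mlieBracket I V W) u =
      dirDeriv I (dirDeriv I h W) V u - dirDeriv I (dirDeriv I h V) W u := by
  have hn : (∞ : WithTop ℕ∞) ≠ 0 := by simp
  -- The bracket at `u` is defined by pulling both fields back to the chart at `u`, so the identity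
  -- reduces to `lieBracket_apply_eq_sub` for `h ∘ e`.
  set e := (extChartAt I u).symm with he
  set y₀ := extChartAt I u u with hy₀
  have hey : e y₀ = u := extChartAt_to_inv u
  have hes : ∀ y ∈ (extChartAt I u).target, ContMDiffAt 𝓘(ℝ, F) I ∞ e y := fun y hy =>
    (contMDiffOn_extChartAt_symm u).contMDiffAt ((isOpen_extChartAt_target u).mem_nhds hy)
  have hei : ∀ y ∈ (extChartAt I u).target, (mfderiv 𝓘(ℝ, F) I e y).IsInvertible := by
    intro y hy
    have := isInvertible_mfderivWithin_extChartAt_symm (I := I) hy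
    rwa [ModelWithCorners.range_eq_univ, mfderivWithin_univ] at this
  have hy₀t : y₀ ∈ (extChartAt I u).target := mem_extChartAt_target u
  have hpull : ∀ X : (x : M) → TangentSpace I x, SmoothField I X →
      DifferentiableAt ℝ (VectorField.mpullback 𝓘(ℝ, F) I e X : F → F) y₀ := by
    intro X hX
    have := ContMDiffAt.mpullback_vectorField_preimage (n := ∞) (m := ∞) (hX (e y₀))
      (hes y₀ hy₀t) (hei y₀ hy₀t) (by simp)
    exact (contMDiffAt_vectorSpace_iff_contDiffAt.1 this).differentiableAt hn
  have happ : ∀ X : (x : M) → TangentSpace I x, ∀ y ∈ (extChartAt I u).target,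
      mfderiv 𝓘(ℝ, F) I e y (VectorField.mpullback 𝓘(ℝ, F) I e X y) = X (e y) := by
    intro X y hy
    rw [VectorField.mpullback_apply]
    exact (hei y hy).self_apply_inverse _
  have hchain : ∀ (k : M → N) (X : (x : M) → TangentSpace I x), ∀ y ∈ (extChartAt I u).target,
      MDifferentiableAt I 𝓘(ℝ, N) k (e y) →
      fderiv ℝ (k ∘ e) y (VectorField.mpullback 𝓘(ℝ, F) I e X y) = dirDeriv I k X (e y) := by
    intro k X y hy hk
    have h1 := mfderiv_comp y hk ((hes y hy).mdifferentiableAt hn)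
    rw [mfderiv_eq_fderiv] at h1
    rw [h1]
    show mfderiv I 𝓘(ℝ, N) k (e y) (mfderiv 𝓘(ℝ, F) I e y _) = _
    rw [happ X y hy]; rfl
  have hhn : ∀ᶠ y in 𝓝 y₀, MDifferentiableAt I 𝓘(ℝ, N) h (e y) := by
    have h1 : ∀ᶠ x in 𝓝 u, ContMDiffAt I 𝓘(ℝ, N) 1 h x :=
      (contMDiffAt_iff_contMDiffAt_nhds (by simp)).1 (hh.of_le (by simp))
    have h2 := (hes y₀ hy₀t).continuousAt.tendsto
    rw [hey] at h2
    filter_upwards [h2.eventually h1] with y hy using hy.mdifferentiableAt (by simp)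
  have hsnd : ∀ X Y : (x : M) → TangentSpace I x, SmoothField I X →
      fderiv ℝ (fun y => fderiv ℝ (h ∘ e) y (VectorField.mpullback 𝓘(ℝ, F) I e X y)) y₀
        (VectorField.mpullback 𝓘(ℝ, F) I e Y y₀) = dirDeriv I (dirDeriv I h X) Y u := by
    intro X Y hX
    have h1 : (fun y => fderiv ℝ (h ∘ e) y (VectorField.mpullback 𝓘(ℝ, F) I e X y)) =ᶠ[𝓝 y₀]
        dirDeriv I h X ∘ e := by
      filter_upwards [hhn, (isOpen_extChartAt_target u).mem_nhds hy₀t] with y hy1 hy2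
      exact hchain h X y hy2 hy1
    have h2 : MDifferentiableAt I 𝓘(ℝ, N) (dirDeriv I h X) (e y₀) := by
      rw [hey]; exact (contMDiffAt_dirDeriv hh (hX u)).mdifferentiableAt hn
    rw [h1.fderiv_eq, hchain _ Y y₀ hy₀t h2, hey]
  have hhe : ContDiffAt ℝ ∞ (h ∘ e) y₀ := by
    refine ContMDiffAt.contDiffAt (ContMDiffAt.comp y₀ ?_ (hes y₀ hy₀t))
    rw [hey]; exact hh
  have key := lieBracket_apply_eq_sub hhe (hpull V hV) (hpull W hW)
  rw [hsnd W V hW, hsnd V W hV] at key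
  rw [← key]
  have h3 : VectorField.mlieBracket I V W u = (mfderiv I 𝓘(ℝ, F) (extChartAt I u) u).inverse
      (VectorField.lieBracket (E := F) ℝ (VectorField.mpullback 𝓘(ℝ, F) I e V)
        (VectorField.mpullback 𝓘(ℝ, F) I e W) y₀) := by
    rw [← VectorField.mlieBracketWithin_univ, VectorField.mlieBracketWithin_apply]
    simp only [ModelWithCorners.range_eq_univ, VectorField.mpullbackWithin_univ,
      Set.preimage_univ, Set.univ_inter]
    exact congrArg (fun w : F => (mfderiv I 𝓘(ℝ, F) (extChartAt I u) u).inverse w)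
      (congrFun (VectorField.lieBracketWithin_univ (𝕜 := ℝ) (E := F)) y₀)
  have h4 : h =ᶠ[𝓝 u] (h ∘ e) ∘ extChartAt I u := by
    filter_upwards [extChartAt_source_mem_nhds (I := I) u] with x hx
    exact congrArg h ((extChartAt I u).left_inv hx).symm
  have h5 : mfderiv I 𝓘(ℝ, N) ((h ∘ e) ∘ extChartAt I u) u =
      (fderiv ℝ (h ∘ e) y₀).comp (mfderiv I 𝓘(ℝ, F) (extChartAt I u) u) := by
    rw [mfderiv_comp u (hhe.differentiableAt hn).mdifferentiableAt
      (contMDiffAt_extChartAt (n := ∞).mdifferentiableAt hn), mfderiv_eq_fderiv]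
    rfl
  show mfderiv I 𝓘(ℝ, N) h u _ = _
  rw [h3]
  have h6 := h4.mfderiv_eq (I := I) (I' := 𝓘(ℝ, N))
  have h7 : ∀ w : TangentSpace I u, (mfderiv I 𝓘(ℝ, N) h u w : N) =
      fderiv ℝ (h ∘ e) y₀ (mfderiv I 𝓘(ℝ, F) (extChartAt I u) u w) := by
    intro w
    have := congrArg (fun A : F →L[ℝ] N => A w) (h6.trans h5)
    exact this
  rw [h7]
  congr 1
  exact (isInvertible_mfderiv_extChartAt (mem_extChartAt_source u)).self_apply_inverse _

end Bracket
end SingularLagrangian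

/-! ### Differentials of local trivializations, and cutoffs -/

namespace SingularLagrangian

section Submersion

set_option linter.unusedSectionVars false

variable {F H : Type*} [NormedAddCommGroup F] [NormedSpace ℝ F] [FiniteDimensional ℝ F]
  [TopologicalSpace H] {I : ModelWithCorners ℝ F H} [I.Boundaryless]
  {M : Type*} [TopologicalSpace M] [ChartedSpace H M] [IsManifold I ∞ M]
  {F' H' : Type*} [NormedAddCommGroup F'] [NormedSpace ℝ F'] [FiniteDimensional ℝ F']
  [TopologicalSpace H'] {I' : ModelWithCorners ℝ F' H'} [I'.Boundaryless]
  {B : Type*} [TopologicalSpace B] [ChartedSpace H' B] [IsManifold I' ∞ B]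

/-- The image `df(X)` of a vector field, with values in the model of the target. -/
noncomputable def pushField (I : ModelWithCorners ℝ F H) (I' : ModelWithCorners ℝ F' H')
    (f : M → B) (X : (u : M) → TangentSpace I u) (u : M) : F' :=
  mfderiv I I' f u (X u)

theorem mfderiv_mem_tangentSpaceOf {f : M → B} (hf : ContMDiff I I' ∞ f) (u : M)
    (x : TangentSpace I u) : mfderiv I I' f u x ∈ tangentSpaceOf I' (Set.range f) (f u) := by
  intro h hh h0
  have hn : (∞ : WithTop ℕ∞) ≠ 0 := by simp
  have h1 : h ∘ f =ᶠ[𝓝 u] fun _ => (0 : ℝ) := by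
    have := (hf.continuous.continuousAt (x := u)).tendsto.eventually (eventually_nhdsWithin_iff.1 h0)
    filter_upwards [this] with y hy using hy ⟨y, rfl⟩
  have h2 := h1.mfderiv_eq (I := I) (I' := 𝓘(ℝ, ℝ))
  rw [mfderiv_comp u (hh.mdifferentiableAt hn) (hf.contMDiffAt.mdifferentiableAt hn),
    mfderiv_const] at h2
  exact congrArg (fun A : F →L[ℝ] ℝ => A x) h2

/-- Differentiate `f (σ (f x, t)) = f x`. The base direction is restricted to the form `df ζ`
because `f ∘ σ` is the first projection only over the image, so only directions coming from `M` may
be used. -/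
theorem mfderiv_section_apply {f : M → B} (hf : ContMDiff I I' ∞ f) {σ : B × F → M} {v : M} {τ : F}
    (hσ : ContMDiffAt (I'.prod 𝓘(ℝ, F)) I ∞ σ (f v, τ))
    (h : ∀ᶠ p in 𝓝 (f v, τ), p.1 ∈ Set.range f → f (σ p) = p.1)
    (ζ : TangentSpace I v) (ξ : F) :
    (mfderiv I I' f (σ (f v, τ)) (mfderiv (I'.prod 𝓘(ℝ, F)) I σ (f v, τ)
      ((mfderiv I I' f v ζ, ξ) : F' × F)) : F') = mfderiv I I' f v ζ := by
  have hn : (∞ : WithTop ℕ∞) ≠ 0 := by simp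
  have hfd := hf.mdifferentiable hn
  let m : M × F → B × F := Prod.map f id
  have hm : MDifferentiableAt (I.prod 𝓘(ℝ, F)) (I'.prod 𝓘(ℝ, F)) m (v, τ) :=
    (hfd v).prodMap mdifferentiableAt_id
  have h1 : f ∘ σ ∘ m =ᶠ[𝓝 (v, τ)] f ∘ Prod.fst := by
    have hc : ContinuousAt m (v, τ) := hm.continuousAt
    filter_upwards [hc.tendsto.eventually h] with q hq using hq ⟨q.1, rfl⟩
  have h2 := h1.mfderiv_eq (I := I.prod 𝓘(ℝ, F)) (I' := I')
  have hσd : MDifferentiableAt (I'.prod 𝓘(ℝ, F)) I σ (m (v, τ)) := hσ.mdifferentiableAt hn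
  rw [mfderiv_comp (v, τ) (hfd (σ (m (v, τ)))) (hσd.comp (v, τ) hm), mfderiv_comp (v, τ) hσd hm,
    mfderiv_comp (v, τ) (hfd v) mdifferentiableAt_fst, mfderiv_fst] at h2
  have h3 := congrArg (fun A : F × F →L[ℝ] F' => A (ζ, ξ)) h2
  have h4 : mfderiv (I.prod 𝓘(ℝ, F)) (I'.prod 𝓘(ℝ, F)) m (v, τ) =
      (mfderiv I I' f v).prodMap (mfderiv 𝓘(ℝ, F) 𝓘(ℝ, F) id τ) :=
    mfderiv_prodMap (f := f) (g := id) (p := (v, τ)) (hfd v) mdifferentiableAt_id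
  rw [h4, mfderiv_id] at h3
  exact h3

/-- Differentiate `σ (f x, chart x) = x`; a kernel vector has no base component, so it is tangent to
the slice through `u`. -/
theorem mfderiv_leftInverse_apply {f : M → B} (hf : ContMDiff I I' ∞ f) {σ : B × F → M} {u : M}
    (hσ : ContMDiffAt (I'.prod 𝓘(ℝ, F)) I ∞ σ (f u, extChartAt I u u))
    (h : ∀ᶠ x in 𝓝 u, σ (f x, extChartAt I u x) = x) {ζ : TangentSpace I u}
    (hζ : mfderiv I I' f u ζ = 0) :
    (mfderiv (I'.prod 𝓘(ℝ, F)) I σ (f u, extChartAt I u u)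
      ((0, mfderiv I 𝓘(ℝ, F) (extChartAt I u) u ζ) : F' × F) : F) = ζ := by
  have hn : (∞ : WithTop ℕ∞) ≠ 0 := by simp
  have hfd := hf.mdifferentiable hn
  let m : M → B × F := fun x => (f x, extChartAt I u x)
  have hχ : MDifferentiableAt I 𝓘(ℝ, F) (extChartAt I u) u :=
    contMDiffAt_extChartAt (n := ∞).mdifferentiableAt hn
  have hm : MDifferentiableAt I (I'.prod 𝓘(ℝ, F)) m u := (hfd u).prodMk hχ
  have h1 : σ ∘ m =ᶠ[𝓝 u] id := h
  have h2 := h1.mfderiv_eq (I := I) (I' := I)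
  have hσd : MDifferentiableAt (I'.prod 𝓘(ℝ, F)) I σ (m u) := hσ.mdifferentiableAt hn
  rw [mfderiv_comp u hσd hm, mfderiv_id] at h2
  have h3 := congrArg (fun A : F →L[ℝ] F => A ζ) h2
  have h4 : mfderiv I (I'.prod 𝓘(ℝ, F)) m u =
      (mfderiv I I' f u).prod (mfderiv I 𝓘(ℝ, F) (extChartAt I u) u) := mfderiv_prodMk (hfd u) hχ
  rw [h4] at h3
  have h5 : ((mfderiv I I' f u).prod (mfderiv I 𝓘(ℝ, F) (extChartAt I u) u)) ζ =
      ((0, mfderiv I 𝓘(ℝ, F) (extChartAt I u) u ζ) : F' × F) := by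
    show (mfderiv I I' f u ζ, mfderiv I 𝓘(ℝ, F) (extChartAt I u) u ζ) = _
    rw [hζ]; rfl
  rw [← h5]
  exact h3

/-- Cutting off a local smooth vector field. -/
theorem exists_smoothField_of_local [T2Space M] {u : M} {U : Set M} (hU : U ∈ 𝓝 u)
    {X : (x : M) → TangentSpace I x} (hX : SmoothFieldOn I X U) :
    ∃ c : M → ℝ, SmoothField I (fun x => c x • X x) ∧ c u = 1 ∧ ∀ x ∉ U, c x = 0 := by
  obtain ⟨ρ, -, hρ⟩ := (SmoothBumpFunction.nhds_basis_tsupport (I := I) u).mem_iff.1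
    (interior_mem_nhds.2 hU)
  refine ⟨ρ, ?_, ρ.eq_one, fun x hx => ?_⟩
  · exact ContMDiffOn.smul_section_of_tsupport (ρ.contMDiff.contMDiffOn) isOpen_interior hρ
      (hX.mono interior_subset)
  · by_contra h
    exact hx (interior_subset (hρ (subset_tsupport _ h)))

theorem contMDiffAt_prod_tangent {E₁ H₁ P : Type*} [NormedAddCommGroup E₁] [NormedSpace ℝ E₁]
    [TopologicalSpace H₁] {J : ModelWithCorners ℝ E₁ H₁} [TopologicalSpace P] [ChartedSpace H₁ P]
    {g : P → TangentBundle I' B} {g' : P → F} {x : P} (ξ : F)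
    (hg : ContMDiffAt J I'.tangent ∞ g x) (hg' : ContMDiffAt J 𝓘(ℝ, F) ∞ g' x) :
    ContMDiffAt J (I'.prod 𝓘(ℝ, F)).tangent ∞
      (fun y => (⟨((g y).proj, g' y), (((g y).snd, ξ) : F' × F)⟩ :
        TangentBundle (I'.prod 𝓘(ℝ, F)) (B × F))) x := by
  have h1 : ContMDiffAt J 𝓘(ℝ, F).tangent ∞ (fun y => (⟨g' y, ξ⟩ : TangentBundle 𝓘(ℝ, F) F)) x := by
    have h2 : ContMDiff 𝓘(ℝ, F) 𝓘(ℝ, F).tangent ∞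
        (fun y : F => (⟨y, ξ⟩ : TangentBundle 𝓘(ℝ, F) F)) :=
      contMDiff_vectorSpace_iff_contDiff.2 (contDiff_const (c := ξ))
    exact h2.contMDiffAt.comp x hg'
  exact (contMDiff_equivTangentBundleProd_symm (I := I') (M := B) (I' := 𝓘(ℝ, F)) (M' := F)
    (n := ∞)).contMDiffAt.comp x (hg.prodMk h1)

end Submersion
end SingularLagrangian

/-! ### Fields in the kernel of a submersion onto its image -/

namespace SingularLagrangian

section Projection

set_option linter.unusedSectionVars false

variable {F H : Type*} [NormedAddCommGroup F] [NormedSpace ℝ F] [FiniteDimensional ℝ F]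
  [TopologicalSpace H] {I : ModelWithCorners ℝ F H} [I.Boundaryless]
  {M : Type*} [TopologicalSpace M] [ChartedSpace H M] [IsManifold I ∞ M]
  {F' H' : Type*} [NormedAddCommGroup F'] [NormedSpace ℝ F'] [FiniteDimensional ℝ F']
  [TopologicalSpace H'] {I' : ModelWithCorners ℝ F' H'} [I'.Boundaryless]
  {B : Type*} [TopologicalSpace B] [ChartedSpace H' B] [IsManifold I' ∞ B]

/-- A smooth map whose image is an embedded submanifold, and which is a submersion onto it. -/
structure IsSubmersionOntoImage (I : ModelWithCorners ℝ F H) (I' : ModelWithCorners ℝ F' H')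
    [IsManifold I ∞ M] [IsManifold I' ∞ B] (f : M → B) : Prop where
  smooth : ContMDiff I I' ∞ f
  image_submanifold : ∃ k : ℕ, IsEmbeddedSubmanifold I' k (Set.range f)
  submersive : ∀ u : M,
    tangentSpaceOf I' (Set.range f) (f u) ≤ LinearMap.range (mfderiv I I' f u).toLinearMap

/-- `σ` inverts near `u` the map `x ↦ (f x, chart x)`, and `σ(·, τ)` are local sections of `f`
over its image. -/
structure IsLocalTrivialization (I : ModelWithCorners ℝ F H) (I' : ModelWithCorners ℝ F' H')
    (f : M → B) (u : M) (σ : B × F → M) : Prop where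
  smooth : ∀ᶠ p in 𝓝 (f u, extChartAt I u u), ContMDiffAt (I'.prod 𝓘(ℝ, F)) I ∞ σ p
  apply_self : σ (f u, extChartAt I u u) = u
  right_inv : ∀ᶠ p in 𝓝 (f u, extChartAt I u u), p.1 ∈ Set.range f → f (σ p) = p.1
  left_inv : ∀ᶠ x in 𝓝 u, σ (f x, extChartAt I u x) = x

variable {f : M → B}

theorem IsSubmersionOntoImage.exists_isLocalTrivialization
    (hf : IsSubmersionOntoImage I I' f) (u : M) :
    ∃ σ : B × F → M, IsLocalTrivialization I I' f u σ := by
  obtain ⟨k, hk⟩ := hf.image_submanifold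
  obtain ⟨σ, h1, h2, h3, h4⟩ := exists_local_trivialization hf.smooth hk u (hf.submersive u)
  exact ⟨σ, h1, h2, h3, h4⟩

theorem tendsto_prodMk_extChartAt (hf : ContMDiff I I' ∞ f) (u : M) :
    Filter.Tendsto (fun x => (f x, extChartAt I u x)) (𝓝 u) (𝓝 (f u, extChartAt I u u)) :=
  hf.continuous.continuousAt.tendsto.prodMk_nhds (continuousAt_extChartAt u).tendsto

/-- Every vector in the kernel of `df` extends to a smooth vector field in the kernel of `df`. -/
theorem IsSubmersionOntoImage.exists_kernelField [T2Space M] (hf : IsSubmersionOntoImage I I' f)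
    {u : M} {ζ : TangentSpace I u} (hζ : mfderiv I I' f u ζ = 0) :
    ∃ G : (x : M) → TangentSpace I x, SmoothField I G ∧ (∀ x, mfderiv I I' f x (G x) = 0) ∧
      G u = ζ := by
  obtain ⟨σ, hσ⟩ := hf.exists_isLocalTrivialization u
  let ξ : F := mfderiv I 𝓘(ℝ, F) (extChartAt I u) u ζ
  -- A fixed slice direction `ξ`, transported by `σ`: slices lie in fibres, so the result is in the
  -- kernel at every nearby `x`.
  let G : (x : M) → TangentSpace I x := fun x =>
    (mfderiv (I'.prod 𝓘(ℝ, F)) I σ (f x, extChartAt I u x) ((0, ξ) : F' × F) : F)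
  have htend := tendsto_prodMk_extChartAt hf.smooth u
  have hev : ∀ᶠ x in 𝓝 u, ContMDiffAt I I.tangent ∞ (fun x => (⟨x, G x⟩ : TangentBundle I M)) x ∧
      mfderiv I I' f x (G x) = 0 := by
    filter_upwards [htend.eventually hσ.smooth, htend.eventually hσ.right_inv.eventually_nhds,
      hσ.left_inv.eventually_nhds, (isOpen_extChartAt_source (I := I) u).mem_nhds
      (mem_extChartAt_source (I := I) u)] with x h1 h2 h3 h4
    have h3x := h3.self_of_nhds
    constructor
    · have h5 : ContMDiffAt I I.tangent ∞ (fun y => tangentMap (I'.prod 𝓘(ℝ, F)) I σ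
          ⟨(f y, extChartAt I u y), ((0, ξ) : F' × F)⟩) x := by
        refine ContMDiffAt.tangentMap_comp (g := fun y => (⟨(f y, extChartAt I u y),
          ((0, ξ) : F' × F)⟩ : TangentBundle (I'.prod 𝓘(ℝ, F)) (B × F))) h1 ?_
        have h6 : ContMDiffAt I I'.tangent ∞
            (fun y => (⟨f y, (0 : F')⟩ : TangentBundle I' B)) x :=
          (Bundle.contMDiff_zeroSection ℝ (TangentSpace I')).contMDiffAt.comp x hf.smooth.contMDiffAt
        exact contMDiffAt_prod_tangent ξ h6
          (contMDiffAt_extChartAt' (by rw [← extChartAt_source I]; exact h4))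
      refine h5.congr_of_eventuallyEq ?_
      filter_upwards [h3] with y hy
      exact congrArg (fun z => (⟨z, (G y : F)⟩ : TangentBundle I M)) hy.symm
    · have h7 := mfderiv_section_apply hf.smooth h1 h2 0 ξ
      rw [map_zero] at h7
      rw [h3x] at h7
      exact h7
  obtain ⟨c, hc, hcu, hc0⟩ := exists_smoothField_of_local (I := I) (U := {x | _}) hev
    (X := G) (fun x hx => hx.1.contMDiffWithinAt)
  refine ⟨fun x => c x • G x, hc, fun x => ?_, ?_⟩
  · by_cases hx : x ∈ {x | ContMDiffAt I I.tangent ∞ (fun x => (⟨x, G x⟩ : TangentBundle I M)) x ∧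
      mfderiv I I' f x (G x) = 0}
    · rw [map_smul, hx.2, smul_zero]
    · show mfderiv I I' f x (c x • G x) = 0
      rw [hc0 x hx, zero_smul, map_zero]
  · show c u • G u = ζ
    rw [hcu, one_smul]
    exact mfderiv_leftInverse_apply hf.smooth hσ.smooth.self_of_nhds hσ.left_inv hζ

/-- `f` read in a chart of the target. -/
theorem chartComp_contMDiffAt (hf : ContMDiff I I' ∞ f) (u : M) {x : M}
    (hx : f x ∈ (extChartAt I' (f u)).source) :
    ContMDiffAt I 𝓘(ℝ, F') ∞ (extChartAt I' (f u) ∘ f) x :=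
  (contMDiffAt_extChartAt' (by rw [← extChartAt_source I']; exact hx)).comp x hf.contMDiffAt

theorem dirDeriv_chartComp (hf : ContMDiff I I' ∞ f) (u : M) {x : M}
    (hx : f x ∈ (extChartAt I' (f u)).source) (X : (x : M) → TangentSpace I x) :
    dirDeriv I (extChartAt I' (f u) ∘ f) X x =
      mfderiv I' 𝓘(ℝ, F') (extChartAt I' (f u)) (f x) (mfderiv I I' f x (X x)) := by
  have hn : (∞ : WithTop ℕ∞) ≠ 0 := by simp
  have h1 : MDifferentiableAt I' 𝓘(ℝ, F') (extChartAt I' (f u)) (f x) :=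
    (contMDiffAt_extChartAt' (n := ∞)
      (by rw [← extChartAt_source I']; exact hx)).mdifferentiableAt hn
  have h2 := mfderiv_comp x h1 (hf.mdifferentiable hn x)
  exact congrArg (fun A : F →L[ℝ] F' => A (X x)) h2

theorem mfderiv_eq_zero_of_dirDeriv_chartComp (hf : ContMDiff I I' ∞ f) {u : M}
    {X : (x : M) → TangentSpace I x} (h : dirDeriv I (extChartAt I' (f u) ∘ f) X u = 0) :
    mfderiv I I' f u (X u) = 0 := by
  rw [dirDeriv_chartComp hf u (mem_extChartAt_source _)] at h
  have hi := isInvertible_mfderiv_extChartAt (I := I') (mem_extChartAt_source (I := I') (f u))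
  have := congrArg (mfderiv I' 𝓘(ℝ, F') (extChartAt I' (f u)) (f u)).inverse h
  rw [hi.inverse_apply_self] at this
  exact this.trans (map_zero _)

/-- For a field `G` in the kernel of `df`, `df([X, G])` is the derivative of `df(X)` along `G`, up
to sign. -/
theorem dirDeriv_mlieBracket_kernelField (hf : ContMDiff I I' ∞ f) (u : M) {x : M}
    (hx : f x ∈ (extChartAt I' (f u)).source) {X G : (x : M) → TangentSpace I x}
    (hX : SmoothField I X) (hG : SmoothField I G) (hG0 : ∀ x, mfderiv I I' f x (G x) = 0) :
    dirDeriv I (extChartAt I' (f u) ∘ f) (VectorField.mlieBracket I X G) x =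
      - dirDeriv I (dirDeriv I (extChartAt I' (f u) ∘ f) X) G x := by
  have hc : CompleteSpace F := FiniteDimensional.complete ℝ F
  rw [dirDeriv_mlieBracket (chartComp_contMDiffAt hf u hx) hX hG]
  have h1 : dirDeriv I (extChartAt I' (f u) ∘ f) G =ᶠ[𝓝 x] fun _ => (0 : F') := by
    filter_upwards [hf.continuous.continuousAt.tendsto.eventually
      ((isOpen_extChartAt_source (I := I') (f u)).mem_nhds hx)] with y hy
    rw [dirDeriv_chartComp hf u hy, hG0 y]
    exact map_zero _
  have h2 : dirDeriv I (dirDeriv I (extChartAt I' (f u) ∘ f) G) X x = 0 := by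
    have := h1.mfderiv_eq (I := I) (I' := 𝓘(ℝ, F'))
    rw [mfderiv_const] at this
    exact congrArg (fun A : F →L[ℝ] F' => A (X x)) this
  rw [h2, zero_sub]

end Projection
end SingularLagrangian

/-! ### Constancy along the fibres -/

namespace SingularLagrangian

section FibreConstancy

set_option linter.unusedSectionVars false

variable {F H : Type*} [NormedAddCommGroup F] [NormedSpace ℝ F] [FiniteDimensional ℝ F]
  [TopologicalSpace H] {I : ModelWithCorners ℝ F H} [I.Boundaryless]
  {M : Type*} [TopologicalSpace M] [ChartedSpace H M] [IsManifold I ∞ M]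
  {F' H' : Type*} [NormedAddCommGroup F'] [NormedSpace ℝ F'] [FiniteDimensional ℝ F']
  [TopologicalSpace H'] {I' : ModelWithCorners ℝ F' H'} [I'.Boundaryless]
  {B : Type*} [TopologicalSpace B] [ChartedSpace H' B] [IsManifold I' ∞ B]
  {f : M → B}

/-- The derivative of a function along a curve `τ ↦ σ (s, τ)` of a local trivialization. -/
theorem fderiv_comp_slice {a : M → F'} {σ : B × F → M} {s : B} {τ : F}
    (hσ : ContMDiffAt (I'.prod 𝓘(ℝ, F)) I ∞ σ (s, τ))
    (ha : MDifferentiableAt I 𝓘(ℝ, F') a (σ (s, τ))) :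
    DifferentiableAt ℝ (fun t => a (σ (s, t))) τ ∧ ∀ ξ : F,
      fderiv ℝ (fun t => a (σ (s, t))) τ ξ = mfderiv I 𝓘(ℝ, F') a (σ (s, τ))
        (mfderiv (I'.prod 𝓘(ℝ, F)) I σ (s, τ) ((0, ξ) : F' × F)) := by
  have hn : (∞ : WithTop ℕ∞) ≠ 0 := by simp
  have hm : MDifferentiableAt 𝓘(ℝ, F) (I'.prod 𝓘(ℝ, F)) (fun t : F => (s, t)) τ :=
    mdifferentiableAt_const.prodMk mdifferentiableAt_id
  have hσd := hσ.mdifferentiableAt hn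
  have h1 := mfderiv_comp τ ha (hσd.comp τ hm)
  rw [mfderiv_comp τ hσd hm, mfderiv_prod_right] at h1
  refine ⟨(ha.comp τ (hσd.comp τ hm)).differentiableAt, fun ξ => ?_⟩
  rw [mfderiv_eq_fderiv] at h1
  exact congrArg (fun A : F →L[ℝ] F' => A ξ) h1

/-- The bracket condition makes the chart expression of `df(X)` have zero derivative in kernel
directions, hence constant on the slice through `u`. -/
theorem IsSubmersionOntoImage.eventually_pushField_eq [T2Space M]
    (hf : IsSubmersionOntoImage I I' f) {X : (x : M) → TangentSpace I x} (hX : SmoothField I X)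
    (hXG : ∀ G : (x : M) → TangentSpace I x, SmoothField I G →
      (∀ x, mfderiv I I' f x (G x) = 0) →
      ∀ x, mfderiv I I' f x (VectorField.mlieBracket I X G x) = 0) (u : M) :
    ∀ᶠ x in 𝓝 u, f x = f u → pushField I I' f X x = pushField I I' f X u := by
  have hn : (∞ : WithTop ℕ∞) ≠ 0 := by simp
  obtain ⟨σ, hσ⟩ := hf.exists_isLocalTrivialization u
  set a := dirDeriv I (extChartAt I' (f u) ∘ f) X with ha
  set τ₀ := extChartAt I u u with hτ₀
  have had : ∀ x, f x ∈ (extChartAt I' (f u)).source → MDifferentiableAt I 𝓘(ℝ, F') a x :=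
    fun x hx => (contMDiffAt_dirDeriv (chartComp_contMDiffAt hf.smooth u hx)
      (hX x)).mdifferentiableAt hn
  have hker : ∀ x, f x ∈ (extChartAt I' (f u)).source → ∀ ζ : TangentSpace I x,
      mfderiv I I' f x ζ = 0 → mfderiv I 𝓘(ℝ, F') a x ζ = 0 := by
    intro x hx ζ hζ
    -- The hypothesis concerns global fields, so the single vector `ζ` has to be extended to one.
    obtain ⟨G, hG, hG0, rfl⟩ := hf.exists_kernelField hζ
    have h1 := dirDeriv_mlieBracket_kernelField hf.smooth u hx hX hG hG0
    rw [dirDeriv_chartComp hf.smooth u hx, hXG G hG hG0 x] at h1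
    exact neg_eq_zero.1 (h1.symm.trans (map_zero _))
  have hline : Filter.Tendsto (fun τ : F => (f u, τ)) (𝓝 τ₀) (𝓝 (f u, τ₀)) :=
    (by fun_prop : Continuous fun τ : F => (f u, τ)).tendsto τ₀
  have hev : ∀ᶠ τ in 𝓝 τ₀, DifferentiableAt ℝ (fun t => a (σ (f u, t))) τ ∧
      fderiv ℝ (fun t => a (σ (f u, t))) τ = 0 := by
    filter_upwards [hline.eventually hσ.smooth, hline.eventually hσ.right_inv.eventually_nhds]
      with τ h1 h2
    have h3 : f (σ (f u, τ)) = f u := h2.self_of_nhds ⟨u, rfl⟩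
    have h4 : f (σ (f u, τ)) ∈ (extChartAt I' (f u)).source := by
      rw [h3]; exact mem_extChartAt_source _
    obtain ⟨h5, h6⟩ := fderiv_comp_slice h1 (had _ h4)
    refine ⟨h5, ?_⟩
    ext ξ
    rw [h6]
    refine hker _ h4 _ ?_
    have h7 := mfderiv_section_apply hf.smooth h1 h2 0 ξ
    rw [map_zero] at h7
    exact h7
  obtain ⟨r, hr, hball⟩ := Metric.eventually_nhds_iff_ball.1 hev
  filter_upwards [(continuousAt_extChartAt u).tendsto.eventually (Metric.ball_mem_nhds τ₀ hr),
    hσ.left_inv] with x hx1 hx2 hx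
  have h1 : a (σ (f u, extChartAt I u x)) = a (σ (f u, τ₀)) :=
    (convex_ball τ₀ r).is_const_of_fderivWithin_eq_zero (𝕜 := ℝ)
      (f := fun t => a (σ (f u, t)))
      (fun t ht => (hball t ht).1.differentiableWithinAt)
      (fun t ht => by
        rw [fderivWithin_of_isOpen Metric.isOpen_ball ht]; exact (hball t ht).2)
      hx1 (Metric.mem_ball_self hr)
  -- A point `x` of the fibre near `u` equals `σ (f u, chart x)`, so it lies on the slice.
  rw [← hx, hx2, hx, hσ.apply_self] at h1
  rw [ha, dirDeriv_chartComp hf.smooth u (mem_extChartAt_source _),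
    dirDeriv_chartComp hf.smooth u (by rw [hx]; exact mem_extChartAt_source _)] at h1
  rw [show f x = f u from hx] at h1
  have hi := isInvertible_mfderiv_extChartAt (I := I') (mem_extChartAt_source (I := I') (f u))
  have h2 := congrArg (mfderiv I' 𝓘(ℝ, F') (extChartAt I' (f u)) (f u)).inverse h1
  erw [hi.inverse_apply_self, hi.inverse_apply_self] at h2
  exact h2

/-- A smooth vector field whose brackets with the fields in the kernel of `df` are in the kernel
of `df` has an image that is constant on the fibres of `f`. -/
theorem IsSubmersionOntoImage.pushField_eq_of_mlieBracket [T2Space M]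
    (hf : IsSubmersionOntoImage I I' f) (hconn : ∀ s ∈ Set.range f, IsConnected (f ⁻¹' {s}))
    {X : (x : M) → TangentSpace I x} (hX : SmoothField I X)
    (hXG : ∀ G : (x : M) → TangentSpace I x, SmoothField I G →
      (∀ x, mfderiv I I' f x (G x) = 0) →
      ∀ x, mfderiv I I' f x (VectorField.mlieBracket I X G x) = 0) {x y : M} (hxy : f x = f y) :
    pushField I I' f X x = pushField I I' f X y := by
  have hpre : PreconnectedSpace (f ⁻¹' {f y}) :=
    isPreconnected_iff_preconnectedSpace.1 (hconn _ ⟨y, rfl⟩).isPreconnected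
  have hloc : IsLocallyConstant (fun z : f ⁻¹' {f y} => pushField I I' f X z) := by
    rw [IsLocallyConstant.iff_eventually_eq]
    intro z
    have := continuous_subtype_val.tendsto z |>.eventually (hf.eventually_pushField_eq hX hXG z)
    filter_upwards [this] with w hw
    exact hw ((show f w = f y from w.2).trans (show f z = f y from z.2).symm)
  exact hloc.apply_eq_of_preconnectedSpace (⟨x, hxy⟩ : f ⁻¹' {f y}) ⟨y, rfl⟩

/-- The bracket of a projectable vector field with a field in the kernel of `df` is in the kernel
of `df`. -/
theorem IsSubmersionOntoImage.mfderiv_mlieBracket_eq_zero (hf : IsSubmersionOntoImage I I' f)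
    {X G : (x : M) → TangentSpace I x} (hX : SmoothField I X) (hG : SmoothField I G)
    (hproj : ∀ x y, f x = f y → pushField I I' f X x = pushField I I' f X y)
    (hG0 : ∀ x, mfderiv I I' f x (G x) = 0) (u : M) :
    mfderiv I I' f u (VectorField.mlieBracket I X G u) = 0 := by
  have hn : (∞ : WithTop ℕ∞) ≠ 0 := by simp
  refine mfderiv_eq_zero_of_dirDeriv_chartComp hf.smooth ?_
  rw [dirDeriv_mlieBracket_kernelField hf.smooth u (mem_extChartAt_source _) hX hG hG0, neg_eq_zero]
  obtain ⟨σ, hσ⟩ := hf.exists_isLocalTrivialization u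
  set a := dirDeriv I (extChartAt I' (f u) ∘ f) X with ha
  set τ₀ := extChartAt I u u with hτ₀
  have had : MDifferentiableAt I 𝓘(ℝ, F') a u :=
    (contMDiffAt_dirDeriv (chartComp_contMDiffAt hf.smooth u (mem_extChartAt_source _))
      (hX u)).mdifferentiableAt hn
  have hline : Filter.Tendsto (fun τ : F => (f u, τ)) (𝓝 τ₀) (𝓝 (f u, τ₀)) :=
    (by fun_prop : Continuous fun τ : F => (f u, τ)).tendsto τ₀
  have hconst : (fun t => a (σ (f u, t))) =ᶠ[𝓝 τ₀] fun _ => a u := by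
    filter_upwards [hline.eventually hσ.right_inv] with τ h2
    have h3 : f (σ (f u, τ)) = f u := h2 ⟨u, rfl⟩
    show a (σ (f u, τ)) = a u
    rw [ha, dirDeriv_chartComp hf.smooth u (by rw [h3]; exact mem_extChartAt_source _),
      dirDeriv_chartComp hf.smooth u (mem_extChartAt_source _)]
    rw [show f (σ (f u, τ)) = f u from h3]
    exact congrArg (fun w : F' => mfderiv I' 𝓘(ℝ, F') (extChartAt I' (f u)) (f u) w)
      (hproj _ _ h3)
  have had' : MDifferentiableAt I 𝓘(ℝ, F') a (σ (f u, τ₀)) := by rw [hσ.apply_self]; exact had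
  -- Along the slice, `G u` is the velocity in this chart direction, and `a` is constant there.
  have h1 := (fderiv_comp_slice hσ.smooth.self_of_nhds had').2
    (mfderiv I 𝓘(ℝ, F) (extChartAt I u) u (G u))
  rw [hconst.fderiv_eq, fderiv_fun_const] at h1
  have h2 := mfderiv_leftInverse_apply hf.smooth hσ.smooth.self_of_nhds hσ.left_inv (hG0 u)
  show mfderiv I 𝓘(ℝ, F') a u (G u) = 0
  rw [← hτ₀] at h2
  erw [h2, hσ.apply_self] at h1
  exact h1.symm

end FibreConstancy
end SingularLagrangian

/-! ### Smoothness of projections and existence of projectable lifts -/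

namespace SingularLagrangian

section Lifts

set_option linter.unusedSectionVars false

variable {F H : Type*} [NormedAddCommGroup F] [NormedSpace ℝ F] [FiniteDimensional ℝ F]
  [TopologicalSpace H] {I : ModelWithCorners ℝ F H} [I.Boundaryless]
  {M : Type*} [TopologicalSpace M] [ChartedSpace H M] [IsManifold I ∞ M]
  {F' H' : Type*} [NormedAddCommGroup F'] [NormedSpace ℝ F'] [FiniteDimensional ℝ F']
  [TopologicalSpace H'] {I' : ModelWithCorners ℝ F' H'} [I'.Boundaryless]
  {B : Type*} [TopologicalSpace B] [ChartedSpace H' B] [IsManifold I' ∞ B]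
  {f : M → B}

theorem contMDiffAt_slice {σ : B × F → M} {s : B} {τ : F}
    (hσ : ContMDiffAt (I'.prod 𝓘(ℝ, F)) I ∞ σ (s, τ)) :
    ContMDiffAt I' I ∞ (fun s => σ (s, τ)) s :=
  ContMDiffAt.comp s hσ (contMDiffAt_id.prodMk contMDiffAt_const)

/-- The projection of a smooth projectable field is smooth along the image. -/
theorem IsSubmersionOntoImage.smoothFieldOn_range (hf : IsSubmersionOntoImage I I' f)
    {X : (x : M) → TangentSpace I x} (hX : SmoothField I X) {Y : (s : B) → TangentSpace I' s}
    (hY : ∀ u, (Y (f u) : F') = pushField I I' f X u) :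
    SmoothFieldOn I' Y (Set.range f) := by
  rintro _ ⟨u, rfl⟩
  obtain ⟨σ, hσ⟩ := hf.exists_isLocalTrivialization u
  set τ₀ := extChartAt I u u with hτ₀
  have hsl : ContMDiffAt I' I ∞ (fun s => σ (s, τ₀)) (f u) :=
    contMDiffAt_slice hσ.smooth.self_of_nhds
  -- Evaluating `df(X)` along the section `σ (·, τ₀)` gives a map smooth at `f u` on the ambient
  -- manifold that agrees with `Y` on the image.
  have h1 : ContMDiffAt I' I'.tangent ∞ (fun s => tangentMap I I' f
      (⟨σ (s, τ₀), X (σ (s, τ₀))⟩ : TangentBundle I M)) (f u) :=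
    ContMDiffAt.tangentMap_comp (g := fun s => (⟨σ (s, τ₀), X (σ (s, τ₀))⟩ : TangentBundle I M))
      hf.smooth.contMDiffAt (ContMDiffAt.comp (f u)
        (g := fun x => (⟨x, X x⟩ : TangentBundle I M)) (hX _) hsl)
  have hline : Filter.Tendsto (fun s : B => (s, τ₀)) (𝓝 (f u)) (𝓝 (f u, τ₀)) :=
    (by fun_prop : Continuous fun s : B => (s, τ₀)).tendsto (f u)
  have hp : ∀ s, s ∈ Set.range f → f (σ (s, τ₀)) = s →
      (⟨s, Y s⟩ : TangentBundle I' B) = tangentMap I I' f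
        (⟨σ (s, τ₀), X (σ (s, τ₀))⟩ : TangentBundle I M) := by
    intro s _ hs
    have h2 := hY (σ (s, τ₀))
    have h3 : (⟨s, Y s⟩ : TangentBundle I' B) = ⟨f (σ (s, τ₀)), Y (f (σ (s, τ₀)))⟩ := by rw [hs]
    rw [h3]
    exact congrArg (fun w : F' => (⟨f (σ (s, τ₀)), w⟩ : TangentBundle I' B)) h2
  refine h1.contMDiffWithinAt.congr_of_eventuallyEq ?_ ?_
  · filter_upwards [nhdsWithin_le_nhds (hline.eventually hσ.right_inv), self_mem_nhdsWithin]
      with s hs1 hs2 using hp s hs2 (hs1 hs2)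
  · exact hp _ ⟨u, rfl⟩ (by rw [hσ.apply_self])

/-- Every vector tangent to the image of `f` is the image of a smooth projectable field. -/
theorem IsSubmersionOntoImage.exists_projectable [T2Space M] [SigmaCompactSpace M] [T2Space B]
    (hf : IsSubmersionOntoImage I I' f) (u : M) (ξ : TangentSpace I u) :
    ∃ X : (x : M) → TangentSpace I x, SmoothField I X ∧
      (∀ x y, f x = f y → pushField I I' f X x = pushField I I' f X y) ∧
      pushField I I' f X u = mfderiv I I' f u ξ := by
  obtain ⟨X₀, hX₀u, hX₀⟩ : ∃ X₀ : (x : M) → TangentSpace I x, X₀ u = ξ ∧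
      ∀ᶠ x in 𝓝 u, ContMDiffAt I I.tangent ∞ (fun x => (⟨x, X₀ x⟩ : TangentBundle I M)) x := by
    obtain ⟨U, hU, hX⟩ := FiberBundle.exists_contMDiffOn_extend (k := ∞) I F ξ
    refine ⟨FiberBundle.extend F ξ, FiberBundle.extend_apply_self F ξ, ?_⟩
    filter_upwards [eventually_mem_nhds_iff.2 hU] with x hx using hX.contMDiffAt hx
  obtain ⟨σ, hσ⟩ := hf.exists_isLocalTrivialization u
  set τ₀ := extChartAt I u u with hτ₀
  have hline : Filter.Tendsto (fun s : B => (s, τ₀)) (𝓝 (f u)) (𝓝 (f u, τ₀)) :=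
    (by fun_prop : Continuous fun s : B => (s, τ₀)).tendsto (f u)
  have hsl : ContMDiffAt I' I ∞ (fun s => σ (s, τ₀)) (f u) :=
    contMDiffAt_slice hσ.smooth.self_of_nhds
  have hslt : Filter.Tendsto (fun s => σ (s, τ₀)) (𝓝 (f u)) (𝓝 u) := by
    have := hsl.continuousAt.tendsto
    rwa [hσ.apply_self] at this
  -- The field to be lifted. Only its values on the image matter, since there `σ (s, τ₀)` lies over
  -- `s`.
  let y : B → F' := fun s => pushField I I' f X₀ (σ (s, τ₀))
  have hW : ∀ᶠ s in 𝓝 (f u), ContMDiffAt (I'.prod 𝓘(ℝ, F)) I ∞ σ (s, τ₀) ∧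
      (s ∈ Set.range f → f (σ (s, τ₀)) = s) ∧
      ContMDiffAt I I.tangent ∞ (fun x => (⟨x, X₀ x⟩ : TangentBundle I M)) (σ (s, τ₀)) := by
    filter_upwards [hline.eventually hσ.smooth, hline.eventually hσ.right_inv,
      hslt.eventually hX₀] with s h1 h2 h3 using ⟨h1, h2, h3⟩
  obtain ⟨W, hWsub, hWo, huW⟩ := mem_nhds_iff.1 hW
  obtain ⟨ρ, -, hρ⟩ := (SmoothBumpFunction.nhds_basis_tsupport (I := I') (f u)).mem_iff.1
    (hWo.mem_nhds huW)
  -- The right-hand side depends on `x` only through `f x`, so any field with values in `t` is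
  -- projectable; each `t x` is affine, hence convex, as the partition of unity requires.
  let t : (x : M) → Set (TangentSpace I x) := fun x =>
    {v | (mfderiv I I' f x v : F') = ρ (f x) • y (f x)}
  have ht : ∀ x, Convex ℝ (t x) := by
    intro x a ha b hb α β _ _ hαβ
    show (mfderiv I I' f x (α • a + β • b) : F') = ρ (f x) • y (f x)
    have h1 : (mfderiv I I' f x (α • a + β • b) : F') =
        α • (mfderiv I I' f x a : F') + β • (mfderiv I I' f x b : F') := by
      rw [map_add, map_smul, map_smul]
    exact h1.trans ((congrArg₂ (fun p q : F' => α • p + β • q) ha hb).trans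
      (Convex.combo_self hαβ _))
  have hloc : ∀ x₁ : M, ∃ U ∈ 𝓝 x₁, ∃ s_loc : (x : M) → TangentSpace I x,
      ContMDiffOn I I.tangent ∞ (fun x => (⟨x, s_loc x⟩ : TangentBundle I M)) U ∧
      ∀ x ∈ U, s_loc x ∈ t x := by
    intro x₁
    by_cases hx₁ : f x₁ ∈ tsupport ρ
    · have hx₁W : f x₁ ∈ W := hρ hx₁
      obtain ⟨σ₁, hσ₁⟩ := hf.exists_isLocalTrivialization x₁
      let Z : (x : M) → TangentSpace I x := fun x =>
        (mfderiv (I'.prod 𝓘(ℝ, F)) I σ₁ (f x, extChartAt I x₁ x) ((y (f x), 0) : F' × F) : F)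
      have htend := tendsto_prodMk_extChartAt hf.smooth x₁
      have hev : ∀ᶠ x in 𝓝 x₁, ContMDiffAt I I.tangent ∞
          (fun x => (⟨x, Z x⟩ : TangentBundle I M)) x ∧ (mfderiv I I' f x (Z x) : F') = y (f x) := by
        filter_upwards [htend.eventually hσ₁.smooth, htend.eventually hσ₁.right_inv.eventually_nhds,
          hσ₁.left_inv.eventually_nhds, (isOpen_extChartAt_source (I := I) x₁).mem_nhds
          (mem_extChartAt_source (I := I) x₁),
          hf.smooth.continuous.continuousAt.preimage_mem_nhds (hWo.mem_nhds hx₁W)]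
          with x h1 h2 h3 h4 h5
        have h3x := h3.self_of_nhds
        obtain ⟨hw1, hw2, hw3⟩ := hWsub h5
        have hfs : f (σ (f x, τ₀)) = f x := hw2 ⟨x, rfl⟩
        constructor
        · have hx : ContMDiffAt I I ∞ (fun x => σ (f x, τ₀)) x :=
            (contMDiffAt_slice hw1).comp x hf.smooth.contMDiffAt
          have h6 : ContMDiffAt I I'.tangent ∞ (fun x => tangentMap I I' f
              (⟨σ (f x, τ₀), X₀ (σ (f x, τ₀))⟩ : TangentBundle I M)) x :=
            ContMDiffAt.tangentMap_comp
              (g := fun x => (⟨σ (f x, τ₀), X₀ (σ (f x, τ₀))⟩ : TangentBundle I M))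
              hf.smooth.contMDiffAt (ContMDiffAt.comp x
                (g := fun x => (⟨x, X₀ x⟩ : TangentBundle I M)) hw3 hx)
          have h7 : ContMDiffAt I I'.tangent ∞
              (fun x => (⟨f x, y (f x)⟩ : TangentBundle I' B)) x := by
            refine h6.congr_of_eventuallyEq ?_
            filter_upwards [hf.smooth.continuous.continuousAt.preimage_mem_nhds
              (hWo.mem_nhds h5)] with z hz
            exact congrArg (fun q => (⟨q, (y (f z) : F')⟩ : TangentBundle I' B))
              ((hWsub hz).2.1 ⟨z, rfl⟩).symm
          have h8 : ContMDiffAt I I.tangent ∞ (fun z => tangentMap (I'.prod 𝓘(ℝ, F)) I σ₁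
              ⟨(f z, extChartAt I x₁ z), ((y (f z), 0) : F' × F)⟩) x := by
            refine ContMDiffAt.tangentMap_comp (g := fun z => (⟨(f z, extChartAt I x₁ z),
              ((y (f z), 0) : F' × F)⟩ : TangentBundle (I'.prod 𝓘(ℝ, F)) (B × F))) h1 ?_
            exact contMDiffAt_prod_tangent (0 : F) h7
              (contMDiffAt_extChartAt' (by rw [← extChartAt_source I]; exact h4))
          refine h8.congr_of_eventuallyEq ?_
          filter_upwards [h3] with z hz
          exact congrArg (fun q => (⟨q, (Z z : F)⟩ : TangentBundle I M)) hz.symm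
        -- The vector `y (f x)` is the image under `df` of `X₀` at `σ (f x, τ₀)`, another point of
        -- the same fibre. This is the form `mfderiv_section_apply` needs.
        · rw [← hfs] at h1 h2
          have h9 := mfderiv_section_apply hf.smooth h1 h2 (X₀ (σ (f x, τ₀))) 0
          rw [hfs] at h9
          rw [h3x] at h9
          exact h9
      refine ⟨{x | _}, hev, fun x => ρ (f x) • Z x, ?_, ?_⟩
      · intro x hx
        exact ((ρ.contMDiff.comp hf.smooth).contMDiffAt.smul_section hx.1).contMDiffWithinAt
      · intro x hx
        show (mfderiv I I' f x (ρ (f x) • Z x) : F') = ρ (f x) • y (f x)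
        rw [← hx.2, map_smul]; rfl
    · refine ⟨f ⁻¹' (tsupport ρ)ᶜ, hf.smooth.continuous.continuousAt.preimage_mem_nhds
        ((isClosed_tsupport ρ).isOpen_compl.mem_nhds hx₁), fun x => 0, ?_, ?_⟩
      · exact (Bundle.contMDiff_zeroSection ℝ (TangentSpace I)).contMDiffOn
      · intro x hx
        show (mfderiv I I' f x 0 : F') = ρ (f x) • y (f x)
        rw [image_eq_zero_of_notMem_tsupport hx, zero_smul]
        exact map_zero _
  obtain ⟨s, hs⟩ := exists_contMDiffSection_forall_mem_convex_of_local (n := ⊤) I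
    (F_fiber := F) (fun x => TangentSpace I x) t ht hloc
  have hpush : ∀ x, pushField I I' f (fun x => s x) x = ρ (f x) • y (f x) := hs
  refine ⟨fun x => s x, s.contMDiff, fun a b hab => ?_, ?_⟩
  · rw [hpush, hpush, hab]
  · rw [hpush, ρ.eq_one, one_smul]
    show pushField I I' f X₀ (σ (f u, τ₀)) = _
    rw [hσ.apply_self, pushField, hX₀u]

end Lifts
end SingularLagrangian

/-! ### Topology of the phase spaces and inclusions of fibres -/

/-- The total space of a fibre bundle with Hausdorff base and fibre is Hausdorff. -/
theorem FiberBundle.t2Space_totalSpace {B F : Type*} [TopologicalSpace B] [TopologicalSpace F]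
    (E : B → Type*) [TopologicalSpace (Bundle.TotalSpace F E)] [∀ b, TopologicalSpace (E b)]
    [FiberBundle F E] [T2Space B] [T2Space F] : T2Space (Bundle.TotalSpace F E) := by
  refine ⟨fun x y hxy => ?_⟩
  by_cases h : x.proj = y.proj
  · set e := trivializationAt F E x.proj
    have hx : x ∈ e.source := FiberBundle.mem_trivializationAt_proj_source
    have hy : y ∈ e.source := by
      rw [e.mem_source, ← h]; exact FiberBundle.mem_baseSet_trivializationAt' x.proj
    have hne : e x ≠ e y := fun h' => hxy (e.injOn hx hy h')
    obtain ⟨U, V, hU, hV, hxU, hyV, hUV⟩ := t2_separation hne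
    refine ⟨e.source ∩ e ⁻¹' U, e.source ∩ e ⁻¹' V,
      e.continuousOn.isOpen_inter_preimage e.open_source hU,
      e.continuousOn.isOpen_inter_preimage e.open_source hV, ⟨hx, hxU⟩, ⟨hy, hyV⟩, ?_⟩
    exact (hUV.preimage e).mono Set.inter_subset_right Set.inter_subset_right
  · exact separated_by_continuous (FiberBundle.continuous_proj F E) h

namespace SingularLagrangian

section Bundles

set_option linter.unusedSectionVars false

variable {E : Type*} [NormedAddCommGroup E] [NormedSpace ℝ E]
  {Q : Type*} [TopologicalSpace Q] [ChartedSpace E Q] [IsManifold 𝓘(ℝ, E) ∞ Q]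

/-- Needed for the partition of unity in `exists_projectable`. Countably many charts of `Q` suffice,
and the bundle charts over them cover `TQ`. -/
theorem sigmaCompactSpace_PL [FiniteDimensional ℝ E] [SecondCountableTopology Q] :
    SigmaCompactSpace (PL E Q) := by
  have hprop : ProperSpace E := FiniteDimensional.proper ℝ E
  have h1 : SecondCountableTopology (ModelProd E E) :=
    inferInstanceAs (SecondCountableTopology (E × E))
  have h2 : LocallyCompactSpace (ModelProd E E) := inferInstanceAs (LocallyCompactSpace (E × E))
  obtain ⟨s, hs, hcov⟩ := TopologicalSpace.countable_cover_nhds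
    (fun q : Q => (chartAt E q).open_source.mem_nhds (mem_chart_source E q))
  have h3 : SecondCountableTopology (PL E Q) := by
    refine ChartedSpace.secondCountable_of_countable_cover (ModelProd E E)
      (s := (fun q : Q => (⟨q, (0 : E)⟩ : PL E Q)) '' s) ?_ (hs.image _)
    refine Set.eq_univ_of_forall fun u => ?_
    obtain ⟨q, hq, hu⟩ := Set.mem_iUnion₂.1 (hcov.symm ▸ Set.mem_univ u.proj :
      u.proj ∈ ⋃ x ∈ s, (chartAt E x).source)
    refine Set.mem_iUnion₂.2 ⟨_, ⟨q, hq, rfl⟩, ?_⟩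
    rw [TangentBundle.mem_chart_source_iff]
    exact hu
  have h4 : LocallyCompactSpace (PL E Q) := ChartedSpace.locallyCompactSpace (ModelProd E E) _
  infer_instance

/-- The inclusion of a fibre into the total space of a vector bundle, read in a trivialization. -/
theorem contMDiff_fibreInclusion {F₁ : Type*} [NormedAddCommGroup F₁] [NormedSpace ℝ F₁]
    {V : Q → Type*} [∀ x, AddCommGroup (V x)] [∀ x, Module ℝ (V x)]
    [TopologicalSpace (Bundle.TotalSpace F₁ V)] [∀ x, TopologicalSpace (V x)]
    [FiberBundle F₁ V] [VectorBundle ℝ F₁ V] [ContMDiffVectorBundle ∞ F₁ V 𝓘(ℝ, E)]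
    (e : Bundle.Trivialization F₁ (Bundle.TotalSpace.proj : Bundle.TotalSpace F₁ V → Q))
    [MemTrivializationAtlas e] {q : Q} (hq : q ∈ e.baseSet) :
    ContMDiff 𝓘(ℝ, F₁) (𝓘(ℝ, E).prod 𝓘(ℝ, F₁)) ∞
      (fun w : F₁ => e.toOpenPartialHomeomorph.symm (q, w)) := by
  intro w
  have h1 : ContMDiffAt 𝓘(ℝ, F₁) (𝓘(ℝ, E).prod 𝓘(ℝ, F₁)) ∞ (fun w : F₁ => (q, w)) w :=
    contMDiffAt_const.prodMk contMDiffAt_id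
  refine ContMDiffAt.comp w ?_ h1
  refine (e.contMDiffOn_symm (n := ∞) (IB := 𝓘(ℝ, E))).contMDiffAt ?_
  exact e.open_target.mem_nhds (e.mem_target.2 hq)

/-- The fibre coordinate of `e` is a smooth left inverse of the inclusion. -/
theorem injective_mfderiv_fibreInclusion {F₁ : Type*} [NormedAddCommGroup F₁] [NormedSpace ℝ F₁]
    {V : Q → Type*} [∀ x, AddCommGroup (V x)] [∀ x, Module ℝ (V x)]
    [TopologicalSpace (Bundle.TotalSpace F₁ V)] [∀ x, TopologicalSpace (V x)]
    [FiberBundle F₁ V] [VectorBundle ℝ F₁ V] [ContMDiffVectorBundle ∞ F₁ V 𝓘(ℝ, E)]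
    (e : Bundle.Trivialization F₁ (Bundle.TotalSpace.proj : Bundle.TotalSpace F₁ V → Q))
    [MemTrivializationAtlas e] {q : Q} (hq : q ∈ e.baseSet) (w : F₁) :
    Function.Injective (mfderiv 𝓘(ℝ, F₁) (𝓘(ℝ, E).prod 𝓘(ℝ, F₁))
      (fun w : F₁ => e.toOpenPartialHomeomorph.symm (q, w)) w) := by
  have hn : (∞ : WithTop ℕ∞) ≠ 0 := by simp
  set j : F₁ → Bundle.TotalSpace F₁ V := fun w => e.toOpenPartialHomeomorph.symm (q, w) with hj
  have hjd : MDifferentiableAt 𝓘(ℝ, F₁) (𝓘(ℝ, E).prod 𝓘(ℝ, F₁)) j w :=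
    (contMDiff_fibreInclusion e hq).mdifferentiable hn w
  have hjs : j w ∈ e.source := e.toOpenPartialHomeomorph.map_target (e.mem_target.2 hq)
  have hr : MDifferentiableAt (𝓘(ℝ, E).prod 𝓘(ℝ, F₁)) 𝓘(ℝ, F₁) (fun x => (e x).2) (j w) :=
    (((e.contMDiffOn (n := ∞) (IB := 𝓘(ℝ, E))).contMDiffAt
      (e.open_source.mem_nhds hjs)).snd).mdifferentiableAt hn
  have h1 : (fun x => (e x).2) ∘ j = id := by
    ext y
    exact congrArg Prod.snd (e.toOpenPartialHomeomorph.right_inv (e.mem_target.2 hq))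
  have h2 := mfderiv_comp w hr hjd
  rw [h1, mfderiv_id] at h2
  intro a b hab
  have h3 := fun y : F₁ => congrArg (fun A : F₁ →L[ℝ] F₁ => A y) h2
  have h4 : ∀ y : F₁, y = mfderiv (𝓘(ℝ, E).prod 𝓘(ℝ, F₁)) 𝓘(ℝ, F₁) (fun x => (e x).2) (j w)
    (mfderiv 𝓘(ℝ, F₁) (𝓘(ℝ, E).prod 𝓘(ℝ, F₁)) j w y) := h3
  rw [show a = _ from h4 a, hab]
  exact (h4 b).symm

end Bundles

/-! ### The fibre derivative: smoothness and kernel of its differential -/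

section FibreDerivative

variable {E : Type*} [NormedAddCommGroup E] [NormedSpace ℝ E]
  {Q : Type*} [TopologicalSpace Q] [ChartedSpace E Q] [IsManifold 𝓘(ℝ, E) ∞ Q]

theorem fibreInclusion_eq (q : Q) (v : E) :
    (⟨q, v⟩ : PL E Q) = (trivializationAt E (TangentSpace 𝓘(ℝ, E) (M := Q)) q).toOpenPartialHomeomorph.symm
      (q, (trivializationAt E (TangentSpace 𝓘(ℝ, E) (M := Q)) q).continuousLinearMapAt ℝ q v) := by
  set e := trivializationAt E (TangentSpace 𝓘(ℝ, E) (M := Q)) q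
  have hq : q ∈ e.baseSet := FiberBundle.mem_baseSet_trivializationAt' q
  have h := e.mk_symm hq (e.continuousLinearMapAt ℝ q v)
  rw [← h]
  have h2 := e.symmL_continuousLinearMapAt (R := ℝ) hq v
  rw [e.symmL_apply hq] at h2
  exact congrArg (fun w : E => (⟨q, w⟩ : PL E Q)) h2.symm

theorem contMDiff_fibreInclusion_PL (q : Q) :
    ContMDiff 𝓘(ℝ, E) (IL E) ∞ (fun v : E => (⟨q, v⟩ : PL E Q)) := by
  set e := trivializationAt E (TangentSpace 𝓘(ℝ, E) (M := Q)) q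
  have hq : q ∈ e.baseSet := FiberBundle.mem_baseSet_trivializationAt' q
  let A : E →L[ℝ] E := e.continuousLinearMapAt ℝ q
  have h1 : (fun v : E => (⟨q, v⟩ : PL E Q)) =
      (fun w : E => e.toOpenPartialHomeomorph.symm (q, w)) ∘ A := by
    ext1 v; exact fibreInclusion_eq q v
  rw [h1]
  exact (contMDiff_fibreInclusion e hq).comp A.contMDiff

theorem contDiff_fibreRestriction {L : PL E Q → ℝ} (hL : ContMDiff (IL E) 𝓘(ℝ, ℝ) ∞ L) (q : Q) :
    ContDiff ℝ ∞ (fibreRestriction L q) :=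
  (hL.comp (contMDiff_fibreInclusion_PL q)).contDiff

theorem pcFibreInclusion_eq (q : Q) (p : E →L[ℝ] ℝ) :
    (⟨q, p⟩ : PC E Q) = (trivializationAt (E →L[ℝ] ℝ)
      (fun q : Q => TangentSpace 𝓘(ℝ, E) q →L[ℝ] Bundle.Trivial Q ℝ q) q).toOpenPartialHomeomorph.symm
      (q, (trivializationAt (E →L[ℝ] ℝ)
      (fun q : Q => TangentSpace 𝓘(ℝ, E) q →L[ℝ] Bundle.Trivial Q ℝ q) q).continuousLinearMapAt ℝ q p) := by
  set e := trivializationAt (E →L[ℝ] ℝ)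
      (fun q : Q => TangentSpace 𝓘(ℝ, E) q →L[ℝ] Bundle.Trivial Q ℝ q) q
  have hq : q ∈ e.baseSet := FiberBundle.mem_baseSet_trivializationAt' q
  have h := e.mk_symm hq (e.continuousLinearMapAt ℝ q p)
  rw [← h]
  have h2 := e.symmL_continuousLinearMapAt (R := ℝ) hq p
  rw [e.symmL_apply hq] at h2
  exact congrArg (fun w : E →L[ℝ] ℝ => (⟨q, w⟩ : PC E Q)) h2.symm

/-- Injectivity is what allows vanishing of the Hessian to be read off from vanishing of $d\mathcal
L$. -/
theorem contMDiff_fibreInclusion_PC (q : Q) :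
    ContMDiff 𝓘(ℝ, E →L[ℝ] ℝ) (IC E) ∞ (fun p : E →L[ℝ] ℝ => (⟨q, p⟩ : PC E Q)) ∧
    ∀ p, Function.Injective (mfderiv 𝓘(ℝ, E →L[ℝ] ℝ) (IC E)
      (fun p : E →L[ℝ] ℝ => (⟨q, p⟩ : PC E Q)) p) := by
  have hn : (∞ : WithTop ℕ∞) ≠ 0 := by simp
  set e := trivializationAt (E →L[ℝ] ℝ)
      (fun q : Q => TangentSpace 𝓘(ℝ, E) q →L[ℝ] Bundle.Trivial Q ℝ q) q
  have hq : q ∈ e.baseSet := FiberBundle.mem_baseSet_trivializationAt' q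
  let A : (E →L[ℝ] ℝ) →L[ℝ] (E →L[ℝ] ℝ) := e.continuousLinearMapAt ℝ q
  have hA : Function.Injective A := fun a b hab => by
    have ha := e.symmL_continuousLinearMapAt (R := ℝ) hq a
    have hb := e.symmL_continuousLinearMapAt (R := ℝ) hq b
    exact ha.symm.trans ((congrArg (e.symmL ℝ q) hab).trans hb)
  have h1 : (fun p : E →L[ℝ] ℝ => (⟨q, p⟩ : PC E Q)) =
      (fun w : E →L[ℝ] ℝ => e.toOpenPartialHomeomorph.symm (q, w)) ∘ A := by
    ext1 v; exact pcFibreInclusion_eq q v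
  rw [h1]
  refine ⟨(contMDiff_fibreInclusion e hq).comp A.contMDiff, fun p => ?_⟩
  rw [mfderiv_comp p ((contMDiff_fibreInclusion e hq).mdifferentiable hn _)
    (A.contMDiff.mdifferentiable hn p), mfderiv_eq_fderiv, A.fderiv]
  exact (injective_mfderiv_fibreInclusion e hq (A p)).comp hA

/-- The vertical vectors are the vectors annihilated by the differential of the projection. -/
theorem exists_verticalLift_eq {u : PL E Q} {x : TangentSpace (IL E) u}
    (hx : mfderiv (IL E) 𝓘(ℝ, E) (fun u : PL E Q => u.proj) u x = 0) :
    ∃ z : E, verticalLift u z = x := by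
  have hn : (∞ : WithTop ℕ∞) ≠ 0 := by simp
  set e := trivializationAt E (TangentSpace 𝓘(ℝ, E) (M := Q)) u.proj with he
  have hq : u.proj ∈ e.baseSet := FiberBundle.mem_baseSet_trivializationAt' u.proj
  have hu : u ∈ e.source := FiberBundle.mem_trivializationAt_proj_source
  let S : E →L[ℝ] E := e.symmL ℝ u.proj
  have hS : ∀ w, S w = e.symm u.proj w := fun w => e.symmL_apply hq w
  let r : PL E Q → E := fun x => (e x).2
  let m : PL E Q → Q × E := fun x => (x.proj, r x)
  have hp : MDifferentiableAt (IL E) 𝓘(ℝ, E) (fun u : PL E Q => u.proj) u :=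
    (Bundle.contMDiffAt_proj (n := ∞) (TangentSpace 𝓘(ℝ, E) (M := Q))).mdifferentiableAt hn
  have hr : MDifferentiableAt (IL E) 𝓘(ℝ, E) r u :=
    (((e.contMDiffOn (n := ∞) (IB := 𝓘(ℝ, E))).contMDiffAt
      (e.open_source.mem_nhds hu)).snd).mdifferentiableAt hn
  have hm : MDifferentiableAt (IL E) (𝓘(ℝ, E).prod 𝓘(ℝ, E)) m u := hp.prodMk hr
  have hs : MDifferentiableAt (𝓘(ℝ, E).prod 𝓘(ℝ, E)) (IL E) e.toOpenPartialHomeomorph.symm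
      (u.proj, r u) :=
    ((e.contMDiffOn_symm (n := ∞) (IB := 𝓘(ℝ, E))).contMDiffAt
      (e.open_target.mem_nhds (e.mem_target.2 hq))).mdifferentiableAt hn
  -- Differentiating this identity at `u` writes any vector through its base and fibre components;
  -- for `x` only the fibre one survives.
  have hid : e.toOpenPartialHomeomorph.symm ∘ m =ᶠ[𝓝 u] id := by
    filter_upwards [e.open_source.mem_nhds hu] with y hy
    have h := e.toOpenPartialHomeomorph.left_inv hy
    have h2 : m y = e y := Prod.ext (e.coe_fst hy).symm rfl
    show e.toOpenPartialHomeomorph.symm (m y) = y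
    rw [h2]; exact h
  have h1 := hid.mfderiv_eq (I := IL E) (I' := IL E)
  rw [mfderiv_comp u hs hm, mfderiv_id] at h1
  have h2 := congrArg (fun A : E × E →L[ℝ] E × E => A x) h1
  have h3 : mfderiv (IL E) (𝓘(ℝ, E).prod 𝓘(ℝ, E)) m u =
      (mfderiv (IL E) 𝓘(ℝ, E) (fun u : PL E Q => u.proj) u).prod
        (mfderiv (IL E) 𝓘(ℝ, E) r u) := mfderiv_prodMk hp hr
  let y : E := mfderiv (IL E) 𝓘(ℝ, E) r u x
  have h4 : (mfderiv (IL E) (𝓘(ℝ, E).prod 𝓘(ℝ, E)) m u x : E × E) = (0, y) := by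
    rw [h3]
    exact Prod.ext hx rfl
  have h5 : (fun w : E => e.toOpenPartialHomeomorph.symm (u.proj, w)) =
      (fun v : E => (⟨u.proj, v⟩ : PL E Q)) ∘ S := by
    ext1 w
    refine (e.mk_symm hq w).symm.trans ?_
    exact congrArg (fun v : E => (⟨u.proj, v⟩ : PL E Q)) (hS w).symm
  have hSr : S (r u) = u.snd := (hS _).trans (e.symm_apply_apply_mk hq u.snd)
  have h6 : mfderiv 𝓘(ℝ, E) (IL E) (fun w : E => e.toOpenPartialHomeomorph.symm (u.proj, w)) (r u) =
      (verticalLift u).comp S := by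
    rw [h5, mfderiv_comp (r u) ((contMDiff_fibreInclusion_PL u.proj).mdifferentiable hn _)
      (S.contMDiff.mdifferentiable (n := ∞) hn _), mfderiv_eq_fderiv, S.fderiv, hSr]
    rfl
  have h7 : mfderiv 𝓘(ℝ, E) (IL E) (fun w : E => e.toOpenPartialHomeomorph.symm (u.proj, w)) (r u) =
      (mfderiv (𝓘(ℝ, E).prod 𝓘(ℝ, E)) (IL E) e.toOpenPartialHomeomorph.symm (u.proj, r u)).comp
        (ContinuousLinearMap.inr ℝ E E) := by
    have hc : MDifferentiableAt 𝓘(ℝ, E) (𝓘(ℝ, E).prod 𝓘(ℝ, E)) (fun w : E => (u.proj, w)) (r u) :=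
      mdifferentiableAt_const.prodMk mdifferentiableAt_id
    have := mfderiv_comp (r u) hs hc
    rw [mfderiv_prod_right] at this
    exact this
  refine ⟨S y, ?_⟩
  have h8 := congrArg (fun A : E →L[ℝ] E × E => A y) (h6.symm.trans h7)
  refine h8.trans (Eq.trans ?_ h2)
  exact congrArg (mfderiv (𝓘(ℝ, E).prod 𝓘(ℝ, E)) (IL E) e.toOpenPartialHomeomorph.symm
    (u.proj, r u)) h4.symm

/-- On a fibre, $\mathcal L$ is by definition $\partial L/\partial v$ followed by the inclusion of
the cotangent fibre; apply the chain rule to both factorizations. -/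
theorem mfderiv_fibreDeriv_verticalLift {L : PL E Q → ℝ}
    (hL : ContMDiff (IL E) (IC E) ∞ (fibreDeriv L)) (hL' : ContMDiff (IL E) 𝓘(ℝ, ℝ) ∞ L)
    (u : PL E Q) (z : E) :
    mfderiv (IL E) (IC E) (fibreDeriv L) u (verticalLift u z) =
      mfderiv 𝓘(ℝ, E →L[ℝ] ℝ) (IC E) (fun p : E →L[ℝ] ℝ => (⟨u.proj, p⟩ : PC E Q))
        (fderiv ℝ (fibreRestriction L u.proj) u.snd) (hessian L u z) := by
  have hn : (∞ : WithTop ℕ∞) ≠ 0 := by simp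
  let i : E → PL E Q := fun v => ⟨u.proj, v⟩
  let i' : (E →L[ℝ] ℝ) → PC E Q := fun p => ⟨u.proj, p⟩
  let v : E := u.snd
  have hi : MDifferentiableAt 𝓘(ℝ, E) (IL E) i v :=
    (contMDiff_fibreInclusion_PL u.proj).mdifferentiable hn _
  have hi' : MDifferentiableAt 𝓘(ℝ, E →L[ℝ] ℝ) (IC E) i'
      (fderiv ℝ (fibreRestriction L u.proj) v) :=
    (contMDiff_fibreInclusion_PC u.proj).1.mdifferentiable hn _
  have hd : DifferentiableAt ℝ (fderiv ℝ (fibreRestriction L u.proj)) v :=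
    ((contDiff_fibreRestriction hL' u.proj).contDiffAt.fderiv_right
      (m := ∞) (by simp)).differentiableAt hn
  have h2 : mfderiv 𝓘(ℝ, E) (IC E) (fibreDeriv L ∘ i) v = _ :=
    mfderiv_comp v (hL.mdifferentiable hn (i v)) hi
  have h3 : mfderiv 𝓘(ℝ, E) (IC E) (i' ∘ fderiv ℝ (fibreRestriction L u.proj)) v = _ :=
    mfderiv_comp v hi' hd.mdifferentiableAt
  rw [mfderiv_eq_fderiv] at h3
  have h4 := h2.symm.trans
    (show mfderiv 𝓘(ℝ, E) (IC E) (fibreDeriv L ∘ i) v = _ from h3)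
  exact congrArg (fun A : E →L[ℝ] E × (E →L[ℝ] ℝ) => A z) h4

/-- The kernel of the differential of the fibre derivative is the vertical kernel
distribution. -/
theorem mfderiv_fibreDeriv_eq_zero_iff {L : PL E Q → ℝ}
    (hL : ContMDiff (IL E) (IC E) ∞ (fibreDeriv L)) (hL' : ContMDiff (IL E) 𝓘(ℝ, ℝ) ∞ L)
    (u : PL E Q) (x : TangentSpace (IL E) u) :
    mfderiv (IL E) (IC E) (fibreDeriv L) u x = 0 ↔ x ∈ verticalKernel L u := by
  have hn : (∞ : WithTop ℕ∞) ≠ 0 := by simp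
  constructor
  · intro hx
    have hp : MDifferentiableAt (IC E) 𝓘(ℝ, E) (fun s : PC E Q => s.proj) (fibreDeriv L u) :=
      (Bundle.contMDiffAt_proj (n := ∞)
        (fun q : Q => TangentSpace 𝓘(ℝ, E) q →L[ℝ] Bundle.Trivial Q ℝ q)).mdifferentiableAt hn
    have h1 := mfderiv_comp u hp (hL.mdifferentiable hn u)
    have h2 : mfderiv (IL E) 𝓘(ℝ, E) (fun u : PL E Q => u.proj) u x = 0 := by
      have h3 := congrArg (fun A : E × E →L[ℝ] E => A x) h1
      refine h3.trans ?_
      show mfderiv (IC E) 𝓘(ℝ, E) (fun s : PC E Q => s.proj) (fibreDeriv L u)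
        (mfderiv (IL E) (IC E) (fibreDeriv L) u x) = 0
      rw [hx]; exact map_zero _
    obtain ⟨z, rfl⟩ := exists_verticalLift_eq h2
    refine ⟨z, ?_, rfl⟩
    rw [mfderiv_fibreDeriv_verticalLift hL hL'] at hx
    exact (contMDiff_fibreInclusion_PC u.proj).2 _ (hx.trans (map_zero _).symm)
  · rintro ⟨z, hz, rfl⟩
    have hz' : hessian L u z = 0 := hz
    refine (mfderiv_fibreDeriv_verticalLift hL hL' u z).trans ?_
    rw [hz']; exact map_zero _

/-- In the trivialization at `u`, the covector part becomes the partial derivative in `w` of the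
smooth function `l x w`, at the smoothly varying point `g x`; smoothness of derivatives with
parameters applies. -/
theorem contMDiff_fibreDeriv {L : PL E Q → ℝ} (hL : ContMDiff (IL E) 𝓘(ℝ, ℝ) ∞ L) :
    ContMDiff (IL E) (IC E) ∞ (fibreDeriv L) := by
  intro u
  have hn : (∞ : WithTop ℕ∞) ≠ 0 := by simp
  set e := trivializationAt E (TangentSpace 𝓘(ℝ, E) (M := Q)) u.proj with he
  have hu : u ∈ e.source := FiberBundle.mem_trivializationAt_proj_source
  have hproj : ContMDiffAt (IL E) 𝓘(ℝ, E) ∞ (fun x : PL E Q => x.proj) u :=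
    Bundle.contMDiffAt_proj (TangentSpace 𝓘(ℝ, E) (M := Q))
  refine (contMDiffAt_hom_bundle (fibreDeriv L)).2 ⟨hproj, ?_⟩
  let l : PL E Q → E → ℝ := fun x w => L (e.toOpenPartialHomeomorph.symm (x.proj, w))
  let g : PL E Q → E := fun x => (e x).2
  have hg : ContMDiffAt (IL E) 𝓘(ℝ, E) ∞ g u :=
    ((e.contMDiffOn (n := ∞) (IB := 𝓘(ℝ, E))).contMDiffAt (e.open_source.mem_nhds hu)).snd
  have hl : ContMDiffAt ((IL E).prod 𝓘(ℝ, E)) 𝓘(ℝ, ℝ) ∞ (Function.uncurry l) (u, g u) := by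
    have h1 : ContMDiffAt ((IL E).prod 𝓘(ℝ, E)) (𝓘(ℝ, E).prod 𝓘(ℝ, E)) ∞
        (fun p : PL E Q × E => (p.1.proj, p.2)) (u, g u) :=
      (hproj.comp (u, g u) contMDiffAt_fst).prodMk contMDiffAt_snd
    refine hL.contMDiffAt.comp (u, g u) (ContMDiffAt.comp (u, g u) ?_ h1)
    refine (e.contMDiffOn_symm (n := ∞) (IB := 𝓘(ℝ, E))).contMDiffAt ?_
    exact e.open_target.mem_nhds (e.mem_target.2 (e.mem_source.1 hu))
  have key := ContMDiffAt.mfderiv (m := ∞) l g hl hg (by simp)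
  refine key.congr_of_eventuallyEq ?_
  filter_upwards [e.open_source.mem_nhds hu] with x hx
  have hxb : x.proj ∈ e.baseSet := e.mem_source.1 hx
  have hLx : DifferentiableAt ℝ (fibreRestriction L x.proj) (x.snd : E) :=
    (contDiff_fibreRestriction hL x.proj).differentiable hn _
  let S : E →L[ℝ] E := e.symmL ℝ x.proj
  have hS : ∀ w, S w = e.symm x.proj w := fun w => e.symmL_apply hxb w
  have hlS : l x = fibreRestriction L x.proj ∘ S := by
    ext w
    show L (e.toOpenPartialHomeomorph.symm (x.proj, w)) = L ⟨x.proj, S w⟩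
    rw [← e.mk_symm hxb]
    exact congrArg (fun v : E => L ⟨x.proj, v⟩) (hS w).symm
  have hSg : S (g x) = x.snd := (hS _).trans (e.symm_apply_apply_mk hxb x.snd)
  have hfd : mfderiv 𝓘(ℝ, E) 𝓘(ℝ, ℝ) (l x) (g x) =
      (fderiv ℝ (fibreRestriction L x.proj) (x.snd : E)).comp S := by
    rw [mfderiv_eq_fderiv, hlS, fderiv_comp _ (by rw [hSg]; exact hLx) S.differentiableAt,
      S.fderiv, hSg]
  refine Eq.trans ?_ ((congrFun (inTangentCoordinates_model_space (I := 𝓘(ℝ, E))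
    (I' := 𝓘(ℝ, ℝ)) g (fun x => l x (g x))
    (fun x => (mfderiv 𝓘(ℝ, E) 𝓘(ℝ, ℝ) (l x) (g x) : E →L[ℝ] ℝ)) u) x).trans hfd).symm
  show (((trivializationAt ℝ (Bundle.Trivial Q ℝ) u.proj).continuousLinearMapAt ℝ x.proj).comp
    ((fderiv ℝ (fibreRestriction L x.proj) (x.snd : E)).comp S)) =
    (fderiv ℝ (fibreRestriction L x.proj) (x.snd : E)).comp S
  have hid : (trivializationAt ℝ (Bundle.Trivial Q ℝ) u.proj).continuousLinearMapAt ℝ x.proj =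
      ContinuousLinearMap.id ℝ ℝ :=
    Bundle.Trivial.continuousLinearMapAt_trivialization ℝ Q ℝ x.proj
  rw [hid]
  rfl

end FibreDerivative
end SingularLagrangian

/-! ### Projectable fields and the projection map -/

namespace SingularLagrangian

section Projection

set_option linter.unusedSectionVars false

variable {E : Type*} [NormedAddCommGroup E] [NormedSpace ℝ E] [FiniteDimensional ℝ E]
  {Q : Type*} [TopologicalSpace Q] [ChartedSpace E Q] [IsManifold 𝓘(ℝ, E) ∞ Q]
  {L : PL E Q → ℝ}

theorem IsAlmostRegular.isSubmersionOntoImage (hL : IsAlmostRegular L) :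
    IsSubmersionOntoImage (IL E) (IC E) (fibreDeriv L) :=
  ⟨contMDiff_fibreDeriv hL.smooth, hL.image_submanifold, hL.submersive⟩

theorem IsAlmostRegular.mfderiv_eq_zero_iff (hL : IsAlmostRegular L) (u : PL E Q)
    (x : TangentSpace (IL E) u) :
    mfderiv (IL E) (IC E) (fibreDeriv L) u x = 0 ↔ x ∈ verticalKernel L u :=
  mfderiv_fibreDeriv_eq_zero_iff (contMDiff_fibreDeriv hL.smooth) hL.smooth u x

theorem tangentMap_eq_mk_of_eq {X : (u : PL E Q) → TangentSpace (IL E) u} {u : PL E Q}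
    {s : PC E Q} (hs : fibreDeriv L u = s) :
    tangentMap (IL E) (IC E) (fibreDeriv L) ⟨u, X u⟩ =
      (⟨s, pushField (F' := E × (E →L[ℝ] ℝ)) (IL E) (IC E) (fibreDeriv L) X u⟩ : TangentBundle (IC E) (PC E Q)) := by
  subst hs; rfl

theorem isProjectable_iff {X : (u : PL E Q) → TangentSpace (IL E) u} :
    IsProjectable L X ↔ ∀ x y, fibreDeriv L x = fibreDeriv L y →
      pushField (IL E) (IC E) (fibreDeriv L) X x =
        pushField (IL E) (IC E) (fibreDeriv L) X y := by
  constructor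
  · intro h x y hxy
    obtain ⟨w, hw⟩ := h (fibreDeriv L y) ⟨y, rfl⟩
    have h1 : ∀ z, fibreDeriv L z = fibreDeriv L y →
        pushField (IL E) (IC E) (fibreDeriv L) X z = w := by
      intro z hz
      have h2 : tangentMap (IL E) (IC E) (fibreDeriv L) ⟨z, X z⟩ ∈
          pushforward L X (fibreDeriv L y) := ⟨z, hz, rfl⟩
      rw [hw] at h2
      exact congrArg (fun p : TangentBundle (IC E) (PC E Q) => (p.snd : E × (E →L[ℝ] ℝ))) h2
    rw [h1 x hxy, h1 y rfl]
  · rintro h _ ⟨x, rfl⟩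
    refine ⟨pushField (F' := E × (E →L[ℝ] ℝ)) (IL E) (IC E) (fibreDeriv L) X x, Set.eq_singleton_iff_unique_mem.2
      ⟨⟨x, rfl, rfl⟩, ?_⟩⟩
    rintro _ ⟨z, hz, rfl⟩
    rw [tangentMap_eq_mk_of_eq hz, h z x hz]

/-- With $\mathcal G=\ker d\mathcal L$, both directions are instances of the general results;
connected fibres serve only to pass from the bracket condition to projectability. -/
theorem IsAlmostRegular.isProjectable_iff_mem_idealFields [T2Space Q] (hL : IsAlmostRegular L)
    {X : (u : PL E Q) → TangentSpace (IL E) u} (hX : SmoothField (IL E) X) :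
    IsProjectable L X ↔ X ∈ idealFields L := by
  have hT2 : T2Space (PL E Q) := FiberBundle.t2Space_totalSpace _
  rw [isProjectable_iff]
  constructor
  · refine fun h => ⟨hX, fun G hG u => ?_⟩
    rw [← hL.mfderiv_eq_zero_iff]
    exact hL.isSubmersionOntoImage.mfderiv_mlieBracket_eq_zero hX hG.1 h
      (fun x => (hL.mfderiv_eq_zero_iff x _).2 (hG.2 x)) u
  · intro h x y hxy
    refine hL.isSubmersionOntoImage.pushField_eq_of_mlieBracket hL.connected_fibres hX ?_ hxy
    intro G hG hG0 u
    rw [hL.mfderiv_eq_zero_iff]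
    exact h.2 G ⟨hG, fun x => (hL.mfderiv_eq_zero_iff x _).1 (hG0 x)⟩ u

/-- A field in $\mathcal G$ projects to zero, hence is projectable; involutivity of $\mathcal G$
comes out as a consequence. -/
theorem IsAlmostRegular.kernelFields_le_idealFields [T2Space Q] (hL : IsAlmostRegular L) :
    kernelFields L ≤ idealFields L := by
  intro X hX
  rw [← hL.isProjectable_iff_mem_idealFields hX.1, isProjectable_iff]
  intro x y _
  have h : ∀ z, pushField (IL E) (IC E) (fibreDeriv L) X z = 0 :=
    fun z => (hL.mfderiv_eq_zero_iff z _).2 (hX.2 z)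
  rw [h, h]

variable (L) in
/-- The image of a vector field at `u`, as a tangent vector at `s`; meaningful for `s = 𝓛 u`. -/
noncomputable def pushAt (u : PL E Q) (s : PC E Q) :
    idealFields L →ₗ[ℝ] TangentSpace (IC E) s where
  toFun X := pushField (F' := E × (E →L[ℝ] ℝ)) (IL E) (IC E) (fibreDeriv L) X.1 u
  map_add' X Y := map_add (mfderiv (IL E) (IC E) (fibreDeriv L) u) (X.1 u) (Y.1 u)
  map_smul' c X := map_smul (mfderiv (IL E) (IC E) (fibreDeriv L) u) c (X.1 u)

variable (L) in
open Classical in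
/-- The image of a vector field at a chosen preimage of each point of the image. -/
noncomputable def projection : idealFields L →ₗ[ℝ] ((s : PC E Q) → TangentSpace (IC E) s) :=
  -- The preimage is chosen independently of the field, which makes linearity immediate. The value 0
  -- off the image lets kernel fields map to the zero function, so the map descends to the quotient.
  LinearMap.pi fun s => if h : s ∈ primaryConstraintSet L then pushAt L h.choose s else 0

theorem projection_of_notMem (X : idealFields L) {s : PC E Q} (h : s ∉ primaryConstraintSet L) :
    projection L X s = 0 := by
  rw [projection, LinearMap.pi_apply, dif_neg h, LinearMap.zero_apply]

/-- Projectability removes the dependence on the chosen preimage. -/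
theorem IsAlmostRegular.projection_fibreDeriv [T2Space Q] (hL : IsAlmostRegular L)
    (X : idealFields L) (u : PL E Q) :
    (projection L X (fibreDeriv L u) : E × (E →L[ℝ] ℝ)) =
      pushField (IL E) (IC E) (fibreDeriv L) X.1 u := by
  have h : fibreDeriv L u ∈ primaryConstraintSet L := ⟨u, rfl⟩
  have h1 : (projection L X (fibreDeriv L u) : E × (E →L[ℝ] ℝ)) =
      pushField (IL E) (IC E) (fibreDeriv L) X.1 h.choose := by
    rw [projection, LinearMap.pi_apply, dif_pos h]; rfl
  rw [h1]
  exact isProjectable_iff.1 ((hL.isProjectable_iff_mem_idealFields X.2.1).2 X.2) _ _ h.choose_spec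

theorem IsAlmostRegular.projection_eq_zero [T2Space Q] (hL : IsAlmostRegular L)
    {X : idealFields L} (hX : X.1 ∈ kernelFields L) : projection L X = 0 := by
  funext s
  by_cases h : s ∈ primaryConstraintSet L
  · obtain ⟨u, rfl⟩ := h
    exact (hL.projection_fibreDeriv X u).trans ((hL.mfderiv_eq_zero_iff u _).2 (hX.2 u))
  · exact projection_of_notMem X h

end Projection
end SingularLagrangian

/-! ### The main theorem -/

theorem mainTheorem2 {E : Type*} [NormedAddCommGroup E] [NormedSpace ℝ E] [FiniteDimensional ℝ E]
    {Q : Type*} [TopologicalSpace Q] [T2Space Q] [SecondCountableTopology Q]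
    [ChartedSpace E Q] [IsManifold 𝓘(ℝ, E) ∞ Q]
    (L : SingularLagrangian.PL E Q → ℝ) (hL : SingularLagrangian.IsAlmostRegular L) :
    -- `𝓖` is contained in the space of the fields for which it is an ideal
    SingularLagrangian.kernelFields L ≤ SingularLagrangian.idealFields L ∧
    -- a smooth vector field is projectable iff `𝓖` is an ideal for it
    (∀ X : (u : SingularLagrangian.PL E Q) → TangentSpace (SingularLagrangian.IL E) u,
      SingularLagrangian.SmoothField (SingularLagrangian.IL E) X →
        (SingularLagrangian.IsProjectable L X ↔ X ∈ SingularLagrangian.idealFields L)) ∧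
    -- the projection descends to the classes modulo `𝓖`
    ∃ Φ : SingularLagrangian.IdealFieldsModKernel L →ₗ[ℝ]
        ((s : SingularLagrangian.PC E Q) → TangentSpace (SingularLagrangian.IC E) s),
      -- the projection of a class is the pushforward of each of its members
      (∀ X : SingularLagrangian.idealFields L, ∀ s ∈ SingularLagrangian.primaryConstraintSet L,
        SingularLagrangian.pushforward L X.1 s = {⟨s, Φ (Submodule.Quotient.mk X) s⟩}) ∧
      -- it is a smooth vector field along the primary constraint submanifold
      (∀ ξ, SingularLagrangian.SmoothFieldOn (SingularLagrangian.IC E) (Φ ξ)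
        (SingularLagrangian.primaryConstraintSet L)) ∧
      -- different classes have different projections
      (∀ ξ η, (∀ s ∈ SingularLagrangian.primaryConstraintSet L, Φ ξ s = Φ η s) → ξ = η) ∧
      -- the classes push forward exactly onto the tangent spaces of the submanifold
      ∀ s ∈ SingularLagrangian.primaryConstraintSet L,
        {w | ∃ ξ, Φ ξ s = w} =
          (SingularLagrangian.tangentSpaceOf (SingularLagrangian.IC E)
            (SingularLagrangian.primaryConstraintSet L) s :
              Set (TangentSpace (SingularLagrangian.IC E) s)) := by
  open SingularLagrangian in
  have hT2L : T2Space (PL E Q) := FiberBundle.t2Space_totalSpace _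
  have hT2C : T2Space (PC E Q) := FiberBundle.t2Space_totalSpace _
  have hσ : SigmaCompactSpace (PL E Q) := sigmaCompactSpace_PL
  have hf := hL.isSubmersionOntoImage
  refine ⟨hL.kernelFields_le_idealFields, fun X hX => hL.isProjectable_iff_mem_idealFields hX,
    ((kernelFields L).submoduleOf (idealFields L)).liftQ (projection L)
      (fun X hX => hL.projection_eq_zero hX), ?_, ?_, ?_, ?_⟩
  · rintro X _ ⟨u, rfl⟩
    refine Set.eq_singleton_iff_unique_mem.2 ⟨⟨u, rfl, ?_⟩, ?_⟩
    · exact congrArg (fun w : E × (E →L[ℝ] ℝ) => (⟨fibreDeriv L u, w⟩ :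
        TangentBundle (IC E) (PC E Q))) (hL.projection_fibreDeriv X u)
    · rintro _ ⟨z, hz, rfl⟩
      rw [tangentMap_eq_mk_of_eq hz]
      rw [← hz]
      exact congrArg (fun w : E × (E →L[ℝ] ℝ) => (⟨fibreDeriv L z, w⟩ :
        TangentBundle (IC E) (PC E Q))) (hL.projection_fibreDeriv X z).symm
  · intro ξ
    obtain ⟨X, rfl⟩ := Submodule.Quotient.mk_surjective _ ξ
    exact hf.smoothFieldOn_range X.2.1 (fun u => hL.projection_fibreDeriv X u)
  · intro ξ η h
    obtain ⟨X, rfl⟩ := Submodule.Quotient.mk_surjective _ ξ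
    obtain ⟨Y, rfl⟩ := Submodule.Quotient.mk_surjective _ η
    rw [Submodule.Quotient.eq]
    refine ⟨(X - Y).2.1, fun u => ?_⟩
    rw [← hL.mfderiv_eq_zero_iff]
    have h1 : pushField (IL E) (IC E) (fibreDeriv L) X.1 u =
        pushField (IL E) (IC E) (fibreDeriv L) Y.1 u :=
      (hL.projection_fibreDeriv X u).symm.trans
        ((h _ ⟨u, rfl⟩).trans (hL.projection_fibreDeriv Y u))
    exact (map_sub (mfderiv (IL E) (IC E) (fibreDeriv L) u) (X.1 u) (Y.1 u)).trans
      (sub_eq_zero.2 h1)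
  · rintro _ ⟨u, rfl⟩
    ext w
    constructor
    · rintro ⟨ξ, rfl⟩
      obtain ⟨X, rfl⟩ := Submodule.Quotient.mk_surjective _ ξ
      have h1 : projection L X (fibreDeriv L u) =
          mfderiv (IL E) (IC E) (fibreDeriv L) u (X.1 u) := hL.projection_fibreDeriv X u
      show projection L X (fibreDeriv L u) ∈ tangentSpaceOf (IC E) (primaryConstraintSet L) _
      rw [h1]
      exact mfderiv_mem_tangentSpaceOf hf.smooth u (X.1 u)
    · intro hw
      -- Submersivity gives a preimage of `w` at the one point `u`; `exists_projectable` turns it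
      -- into a projectable field with the same image there.
      obtain ⟨ξ, rfl⟩ := hL.submersive u hw
      obtain ⟨X, hX, hproj, hXu⟩ := hf.exists_projectable u ξ
      let X' : idealFields L := ⟨X, (hL.isProjectable_iff_mem_idealFields hX).1
        (isProjectable_iff.2 hproj)⟩
      exact ⟨Submodule.Quotient.mk X', (hL.projection_fibreDeriv X' u).trans hXu⟩
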